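/- Let $k$ be a field, $H$ a finite-dimensional Hopf algebra over $k$ with comultiplication $\Delta(h)=\sum h_1\otimes h_2$ and counit $\varepsilon$, and $R$ an associative $k$-algebra with unit. Let $H$ act weakly on $R$, i.e. let $H\otimes R\to R$, $h\otimes a\mapsto h\cdot a$, be a linear map with $1\cdot a=a$, $h\cdot(ab)=\sum(h_1\cdot a)(h_2\cdot b)$ and $h\cdot 1=\varepsilon(h)1$. Suppose that the weak action is inner: there is a convolution invertible linear map $u:H\to R$ with $h\cdot a=\sum u(h_1)\,a\,u^{-1}(h_2)$ for all $h\in H$, $a\in R$. Ideals are two-sided. For a ring $A$ let $r_b(A)$ be its Baer (prime) radical, the intersection of all prime ideals of $A$. An $H$-ideal of $R$ is an ideal $I$ with $H\cdot I\subseteq I$; an $H$-ideal $I$ is $H$-semiprime if every $H$-ideal $J$ of $R$ with $J^n\subseteq I$ for some $n$ is contained in $I$. Let $r_{Hb}(R)$ be the intersection of all $H$-semiprime ideals of $R$, and let $r_{bH}(R)=(r_b(R):H)=\{a\in R\mid h\cdot a\in r_b(R)\text{ for all }h\in H\}$. (1) $r_{Hb}(R)=r_b(R)=r_{bH}(R)$.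 (2) Suppose moreover that $H$ is semisimple. Let $\sigma:H\otimes H\to R$ be a convolution invertible linear map such that, for all $h,g,m\in H$ and $r\in R$, $$h\cdot(g\cdot r)=\sum\sigma(h_1,g_1)\,(h_2g_2\cdot r)\,\sigma^{-1}(h_3,g_3),\qquad \sigma(h,1)=\sigma(1,h)=\varepsilon(h)1,$$ $$\sum\bigl(h_1\cdot\sigma(g_1,m_1)\bigr)\,\sigma(h_2,g_2m_2)=\sum\sigma(h_1,g_1)\,\sigma(h_2g_2,m),$$ and let $R\#_\sigma H$ be the crossed product, that is, the vector space $R\otimes H$ (with $a\otimes h$ written $a\#h$) with the multiplication $(a\#h)(b\#g)=\sum a\,(h_1\cdot b)\,\sigma(h_2,g_1)\#h_3g_2$. Then $$r_b(R\#_\sigma H)=r_{Hb}(R)\#_\sigma H,$$ where for an ideal $I$ of $R$, $I\#_\sigma H$ denotes the image of $I\otimes H$ in $R\otimes H$. -/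

import Mathlib

open TensorProduct Coalgebra WithConv

noncomputable section

/-! ## Radicals of noncommutative rings

An `Ideal` of a noncommutative ring is a left ideal in Mathlib; it is an ideal in the sense of ring
theory when it is `IsTwoSided`. Products and powers are the usual ones of ideals. -/

/-- `P` is a prime ideal of the (noncommutative) ring `A`: a proper two-sided ideal such that
`I J ⊆ P` implies `I ⊆ P` or `J ⊆ P` for all two-sided ideals `I`, `J`. -/
structure IsPrimeIdeal {A : Type*} [Ring A] (P : Ideal A) : Prop where
  isTwoSided : P.IsTwoSided
  ne_top : P ≠ ⊤
  le_or_le : ∀ I J : Ideal A, I.IsTwoSided → J.IsTwoSided → I * J ≤ P → I ≤ P ∨ J ≤ P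

/-- The Baer (prime) radical `r_b(A)`: the intersection of all prime ideals of `A`. -/
def baerRadical (A : Type*) [Ring A] : Ideal A := sInf {P | IsPrimeIdeal P}

/-! ## Weak actions -/

/-- A weak action of the bialgebra `H` on the algebra `R`: a linear map `h ⊗ a ↦ h · a` with
`1 · a = a`, `h · (a b) = ∑ (h₁ · a) (h₂ · b)` and `h · 1 = ε(h) 1`. -/
structure WeakAction (k H R : Type*) [Field k] [Ring H] [Bialgebra k H] [Ring R] [Algebra k R] where
  act : H →ₗ[k] R →ₗ[k] R
  one_act : ∀ a, act 1 a = a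
  act_mul : ∀ h a b, act h (a * b) =
    LinearMap.mul' k R (TensorProduct.map (act.flip a) (act.flip b) (comul (R := k) h))
  act_one : ∀ h, act h 1 = algebraMap k R (counit h)

namespace WeakAction

variable {k H R : Type*} [Field k] [Ring H] [Bialgebra k H] [Ring R] [Algebra k R]
  (W : WeakAction k H R)

/-- The weak action is inner: there is a convolution invertible linear map `u : H → R` with
`h · a = ∑ u(h₁) a u⁻¹(h₂)`. -/
def IsInner : Prop :=
  ∃ u : (WithConv (H →ₗ[k] R))ˣ, ∀ h a, W.act h a =
    LinearMap.mul' k R (TensorProduct.map (LinearMap.mulRight k a ∘ₗ u.val.ofConv)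
      u.inv.ofConv (comul (R := k) h))

/-- An `H`-ideal of `R`: a two-sided ideal `I` with `H · I ⊆ I`. -/
structure IsHIdeal (I : Ideal R) : Prop where
  isTwoSided : I.IsTwoSided
  act_mem : ∀ h, ∀ a ∈ I, W.act h a ∈ I

/-- An `H`-semiprime ideal of `R`: an `H`-ideal `I` such that every `H`-ideal which is nilpotent
modulo `I` is contained in `I`, i.e. `R / I` has no nonzero nilpotent `H`-ideal. -/
structure IsHSemiprimeIdeal (I : Ideal R) : Prop where
  isHIdeal : W.IsHIdeal I
  le_of_pow_le : ∀ J : Ideal R, W.IsHIdeal J → ∀ n : ℕ, J ^ n ≤ I → J ≤ I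

/-- The `H`-Baer radical `r_{Hb}(R)`: the intersection of all `H`-semiprime ideals of `R`. -/
def hBaerRadical : Ideal R := sInf {I | W.IsHSemiprimeIdeal I}

/-- `(I : H) = {a ∈ R | h · a ∈ I for all h ∈ H}`. -/
def colon (I : Ideal R) : Ideal R where
  carrier := {a | ∀ h, W.act h a ∈ I}
  zero_mem' h := by simp
  add_mem' {a b} ha hb h := by
    simpa using I.add_mem (ha h) (hb h)
  smul_mem' r a ha h := by
    rw [smul_eq_mul, W.act_mul, ← (ℛ k h).eq]
    simpa using sum_mem fun i _ => I.mul_mem_left _ (ha _)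

/-- `r_{bH}(R) = (r_b(R) : H)`. -/
def baerRadicalH : Ideal R := W.colon (baerRadical R)

/-- For a linear map `f : C → R`, the linear map `H ⊗ C → R`, `h ⊗ c ↦ h · f(c)`. -/
def actOn {C : Type*} [AddCommGroup C] [Module k C] (f : C →ₗ[k] R) : H ⊗[k] C →ₗ[k] R :=
  TensorProduct.lift (W.act.compl₂ f)

@[simp] lemma actOn_tmul {C : Type*} [AddCommGroup C] [Module k C] (f : C →ₗ[k] R) (h : H) (c : C) :
    W.actOn f (h ⊗ₜ c) = W.act h (f c) := rfl

end WeakAction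

section Counit

variable {k H R : Type*} [Field k] [Ring H] [Bialgebra k H] [Ring R] [Algebra k R]

/-- For a linear map `f : C → R`, the linear map `C ⊗ H → R`, `c ⊗ h ↦ f(c) ε(h)`. -/
def mulCounit (H : Type*) [Ring H] [Bialgebra k H] {C : Type*} [AddCommGroup C] [Module k C]
    (f : C →ₗ[k] R) : C ⊗[k] H →ₗ[k] R :=
  (TensorProduct.rid k R).toLinearMap ∘ₗ TensorProduct.map f counit

@[simp] lemma mulCounit_tmul {C : Type*} [AddCommGroup C] [Module k C] (f : C →ₗ[k] R)
    (c : C) (h : H) : mulCounit H f (c ⊗ₜ h) = counit (R := k) h • f c := by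
  simp [mulCounit]

end Counit

/-! ## Crossed products -/

/-- The data of a crossed product `R #_σ H` over a given weak action of `H` on `R`: a convolution
invertible linear map `σ : H ⊗ H → R` such that
* `R` is a twisted `H`-module: `h · (g · r) = ∑ σ(h₁, g₁) (h₂ g₂ · r) σ⁻¹(h₃, g₃)`;
* `σ` is normalised: `σ(h, 1) = σ(1, h) = ε(h) 1`;
* `σ` is a cocycle:
  `∑ (h₁ · σ(g₁, m₁)) σ(h₂, g₂ m₂) = ∑ σ(h₁, g₁) σ(h₂ g₂, m)`.

The identities are written in the convolution algebras of linear maps from `H ⊗ H` and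
`H ⊗ (H ⊗ H)` to `R`, the products on both sides being convolution products. -/
structure CrossedSystem {k H R : Type*} [Field k] [Ring H] [Bialgebra k H] [Ring R] [Algebra k R]
    (W : WeakAction k H R) where
  σ : (WithConv (H ⊗[k] H →ₗ[k] R))ˣ
  twisted : ∀ r : R, toConv (W.actOn (W.act.flip r)) =
    σ.val * toConv (W.act.flip r ∘ₗ LinearMap.mul' k H) * σ.inv
  apply_one_right : ∀ h, σ.val (h ⊗ₜ 1) = algebraMap k R (counit h)
  apply_one_left : ∀ h, σ.val (1 ⊗ₜ h) = algebraMap k R (counit h)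
  cocycle :
    toConv (W.actOn σ.val.ofConv) *
        toConv (σ.val.ofConv ∘ₗ (LinearMap.mul' k H).lTensor H) =
      toConv (mulCounit H σ.val.ofConv ∘ₗ (TensorProduct.assoc k H H H).symm.toLinearMap) *
        toConv (σ.val.ofConv ∘ₗ (LinearMap.mul' k H).rTensor H ∘ₗ
          (TensorProduct.assoc k H H H).symm.toLinearMap)

namespace CrossedSystem

variable {k H R : Type*} [Field k] [Ring H] [Bialgebra k H] [Ring R] [Algebra k R]
  {W : WeakAction k H R} (c : CrossedSystem W)

/-- `h ⊗ g ↦ ∑ (h₁ · b) ε(g₁) ⊗ 1` as an element of the convolution algebra of linear maps from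
`H ⊗ H` to the ordinary tensor product algebra `R ⊗ H`. -/
def actPart (W : WeakAction k H R) (b : R) : WithConv (H ⊗[k] H →ₗ[k] R ⊗[k] H) :=
  toConv (Algebra.TensorProduct.includeLeft.toLinearMap ∘ₗ mulCounit H (W.act.flip b))

/-- `h ⊗ g ↦ ∑ σ(h₁, g₁) ⊗ h₂ g₂`, the convolution product of `σ ⊗ 1` and of `1 ⊗ mult`. -/
def cocyclePart : WithConv (H ⊗[k] H →ₗ[k] R ⊗[k] H) :=
  toConv (Algebra.TensorProduct.includeLeft.toLinearMap ∘ₗ c.σ.val.ofConv) *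
    toConv (Algebra.TensorProduct.includeRight.toLinearMap ∘ₗ LinearMap.mul' k H)

/-- `b ↦ (h ⊗ g ↦ ∑ (h₁ · b) σ(h₂, g₁) ⊗ h₃ g₂)`, which is the product `(1 # h) (b # g)`. -/
def straighten : R →ₗ[k] (H ⊗[k] H →ₗ[k] R ⊗[k] H) where
  toFun b := (actPart W b * c.cocyclePart).ofConv
  map_add' a b := by
    have : actPart W (a + b) = actPart W a + actPart W b := by
      refine WithConv.ext (TensorProduct.ext' fun x y => ?_)
      simp only [actPart, WithConv.ofConv_add, WithConv.ofConv_toConv, LinearMap.add_apply,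
        LinearMap.comp_apply, mulCounit_tmul, LinearMap.flip_apply, map_add, smul_add]
    rw [this, add_mul, ofConv_add]
  map_smul' r b := by
    have : actPart W (r • b) = r • actPart W b := by
      refine WithConv.ext (TensorProduct.ext' fun x y => ?_)
      simp only [actPart, WithConv.ofConv_smul, WithConv.ofConv_toConv, LinearMap.smul_apply,
        LinearMap.comp_apply, mulCounit_tmul, LinearMap.flip_apply, map_smul]
      exact smul_comm _ _ _
    rw [this, smul_mul_assoc, ofConv_smul, RingHom.id_apply]

/-- The operator of left multiplication by `1 # h`. -/
def leftMulH : H →ₗ[k] Module.End k (R ⊗[k] H) :=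
  (TensorProduct.lift.equiv (RingHom.id k) R H (R ⊗[k] H)).toLinearMap ∘ₗ
    ((TensorProduct.lift.equiv (RingHom.id k) H H (R ⊗[k] H)).symm.toLinearMap ∘ₗ
      c.straighten).flip

lemma leftMulH_tmul (h : H) (b : R) (g : H) :
    c.leftMulH h (b ⊗ₜ g) = c.straighten b (h ⊗ₜ g) := rfl

/-- The multiplication of `R #_σ H` on the vector space `R ⊗ H`. -/
def mulMap : R ⊗[k] H →ₗ[k] R ⊗[k] H →ₗ[k] R ⊗[k] H :=
  TensorProduct.lift ((LinearMap.mul k (Module.End k (R ⊗[k] H))).compl₁₂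
    (Algebra.lsmul k k (R ⊗[k] H)).toLinearMap c.leftMulH)

lemma mulMap_tmul (a b : R) (h g : H) :
    c.mulMap (a ⊗ₜ h) (b ⊗ₜ g) = a • (actPart W b * c.cocyclePart) (h ⊗ₜ g) := rfl

/-! ### The ring axioms -/

lemma conv_tmul {D C A : Type*} [AddCommGroup D] [Module k D] [Coalgebra k D] [AddCommGroup C]
    [Module k C] [Coalgebra k C] [Ring A] [Algebra k A]
    (f g : WithConv (D ⊗[k] C →ₗ[k] A)) (h : D) (x : C) :
    (f * g) (h ⊗ₜ x) = ∑ i ∈ (ℛ k h).index, ∑ j ∈ (ℛ k x).index,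
      f ((ℛ k h).left i ⊗ₜ (ℛ k x).left j) * g ((ℛ k h).right i ⊗ₜ (ℛ k x).right j) := by
  rw [LinearMap.convMul_apply, TensorProduct.comul_tmul, ← (ℛ k h).eq, ← (ℛ k x).eq]
  simp [sum_tmul, tmul_sum]
  rw [Finset.sum_comm]

lemma includeLeft_mul (a : R) (x : R ⊗[k] H) :
    (Algebra.TensorProduct.includeLeft : R →ₐ[k] R ⊗[k] H) a * x = a • x := by
  induction x with
  | zero => simp
  | tmul b h => simp [smul_tmul']
  | add x y hx hy => rw [mul_add, hx, hy, smul_add]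

lemma mulCounit_conv_tmul {C : Type*} [AddCommGroup C] [Module k C] [Coalgebra k C]
    (f : C →ₗ[k] R) (Q : WithConv (C ⊗[k] H →ₗ[k] R ⊗[k] H)) (x : C) (g : H) :
    (toConv ((Algebra.TensorProduct.includeLeft : R →ₐ[k] R ⊗[k] H).toLinearMap ∘ₗ
        mulCounit H f) * Q) (x ⊗ₜ g) =
      ∑ i ∈ (ℛ k x).index, f ((ℛ k x).left i) • Q ((ℛ k x).right i ⊗ₜ g) := by
  rw [conv_tmul]
  refine Finset.sum_congr rfl fun i _ => ?_
  have := congrArg (fun z => f ((ℛ k x).left i) •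
    Q ((ℛ k x).right i ⊗ₜ[k] z)) (Coalgebra.sum_counit_smul (ℛ k g))
  simp only [tmul_sum, tmul_smul, map_sum, map_smul, Finset.smul_sum] at this
  rw [← this]
  refine Finset.sum_congr rfl fun j _ => ?_
  simp only [LinearMap.comp_apply, mulCounit_tmul, map_smul, AlgHom.toLinearMap_apply]
  rw [smul_mul_assoc, includeLeft_mul, smul_comm]

/-- `∑ (h₁ · b) Q(h₂ ⊗ g)` is the convolution product of `actPart W b` and `Q`. -/
lemma actPart_mul_tmul (b : R) (Q : WithConv (H ⊗[k] H →ₗ[k] R ⊗[k] H)) (h g : H) :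
    (actPart W b * Q) (h ⊗ₜ g) = ∑ i ∈ (ℛ k h).index,
      W.act ((ℛ k h).left i) b • Q ((ℛ k h).right i ⊗ₜ g) :=
  mulCounit_conv_tmul (W.act.flip b) Q h g

lemma actPart_mul_actPart (a b : R) :
    actPart W (a * b) = actPart W a * actPart W b := by
  refine WithConv.ext (TensorProduct.ext' fun h g => ?_)
  change _ = (actPart W a * actPart W b) (h ⊗ₜ[k] g)
  rw [actPart_mul_tmul]
  simp only [actPart, WithConv.ofConv_toConv, LinearMap.comp_apply, mulCounit_tmul,
    LinearMap.flip_apply, map_smul, AlgHom.toLinearMap_apply, W.act_mul]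
  rw [← (ℛ k h).eq]
  simp [Finset.smul_sum, smul_tmul']

lemma leftMulH_smul (h : H) (b : R) (y : R ⊗[k] H) :
    c.leftMulH h (b • y) = ∑ i ∈ (ℛ k h).index,
      W.act ((ℛ k h).left i) b • c.leftMulH ((ℛ k h).right i) y := by
  induction y with
  | zero => simp
  | add x y hx hy => simp only [smul_add, map_add, hx, hy, Finset.sum_add_distrib]
  | tmul d m =>
    rw [smul_tmul', smul_eq_mul, leftMulH_tmul]
    change (actPart W (b * d) * c.cocyclePart) (h ⊗ₜ[k] m) = _
    rw [actPart_mul_actPart, mul_assoc, actPart_mul_tmul]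
    rfl

lemma actOn_conv {C : Type*} [AddCommGroup C] [Module k C] [Coalgebra k C]
    (f g : WithConv (C →ₗ[k] R)) :
    toConv (W.actOn (f * g).ofConv) = toConv (W.actOn f.ofConv) * toConv (W.actOn g.ofConv) := by
  refine WithConv.ext (TensorProduct.ext' fun h x => ?_)
  change _ = (toConv (W.actOn f.ofConv) * toConv (W.actOn g.ofConv)) (h ⊗ₜ[k] x)
  rw [conv_tmul]
  simp only [WeakAction.actOn_tmul]
  rw [(ℛ k x).convMul_apply, map_sum, Finset.sum_comm]
  refine Finset.sum_congr rfl fun j _ => ?_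
  rw [W.act_mul, ← (ℛ k h).eq]
  simp

lemma leftMulH_conv {C : Type*} [AddCommGroup C] [Module k C] [Coalgebra k C]
    (f : C →ₗ[k] R) (p : C →ₗc[k] H) (h : H) (x : C) :
    c.leftMulH h ((toConv (Algebra.TensorProduct.includeLeft.toLinearMap ∘ₗ f) *
      toConv (Algebra.TensorProduct.includeRight.toLinearMap ∘ₗ p.toLinearMap) :
        WithConv (C →ₗ[k] R ⊗[k] H)) x) =
    (toConv (Algebra.TensorProduct.includeLeft.toLinearMap ∘ₗ W.actOn f) *
      toConv (c.cocyclePart.ofConv ∘ₗ p.toLinearMap.lTensor H) :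
        WithConv (H ⊗[k] C →ₗ[k] R ⊗[k] H)) (h ⊗ₜ x) := by
  rw [(ℛ k x).convMul_apply, conv_tmul, map_sum, Finset.sum_comm]
  refine Finset.sum_congr rfl fun j _ => ?_
  simp only [LinearMap.comp_apply, AlgHom.toLinearMap_apply, includeLeft_mul,
    LinearMap.lTensor_tmul, WeakAction.actOn_tmul]
  rw [Algebra.TensorProduct.includeRight_apply, smul_tmul', smul_eq_mul, mul_one, leftMulH_tmul]
  exact actPart_mul_tmul ..

variable (k H) in
/-- The multiplication of a bialgebra as a morphism of coalgebras. -/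
def mulCoalgHom : H ⊗[k] H →ₗc[k] H where
  __ := LinearMap.mul' k H
  counit_comp := by ext; simp [mul_comm]
  map_comp_comul := by
    refine TensorProduct.ext' fun x y => ?_
    simp only [LinearMap.comp_apply, TensorProduct.comul_tmul, LinearMap.mul'_apply,
      Bialgebra.comul_mul]
    rw [← (ℛ k x).eq, ← (ℛ k y).eq]
    simp [sum_tmul, tmul_sum, Finset.sum_mul_sum]
    rw [Finset.sum_comm]

lemma mulCounit_conv {C : Type*} [AddCommGroup C] [Module k C] [Coalgebra k C]
    (f g : WithConv (C →ₗ[k] R)) :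
    toConv (mulCounit H (f * g).ofConv) =
      toConv (mulCounit H f.ofConv) * toConv (mulCounit H g.ofConv) := by
  refine WithConv.ext (TensorProduct.ext' fun x h => ?_)
  change _ = (toConv (mulCounit H f.ofConv) * toConv (mulCounit H g.ofConv)) (x ⊗ₜ[k] h)
  rw [conv_tmul]
  simp only [mulCounit_tmul]
  rw [(ℛ k x).convMul_apply, Finset.smul_sum]
  refine Finset.sum_congr rfl fun i _ => ?_
  have := congrArg (fun z => counit (R := k) z • (f ((ℛ k x).left i) * g ((ℛ k x).right i)))
    (Coalgebra.sum_counit_smul (ℛ k h))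
  simp only [map_sum, map_smul, Finset.sum_smul] at this
  rw [← this]
  refine Finset.sum_congr rfl fun j _ => ?_
  rw [smul_mul_smul_comm, smul_eq_mul]

/-- The associator `H ⊗ (H ⊗ H) → (H ⊗ H) ⊗ H`. -/
def assocInv (k H : Type*) [Field k] [Ring H] [Bialgebra k H] :
    H ⊗[k] (H ⊗[k] H) →ₗc[k] (H ⊗[k] H) ⊗[k] H :=
  ((Coalgebra.TensorProduct.assoc k k H H H).symm : _ ≃ₗc[k] _)

lemma comp_conv {C D A : Type*} [AddCommGroup D] [Module k D] [Coalgebra k D] [AddCommGroup C]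
    [Module k C] [Coalgebra k C] [Ring A] [Algebra k A] (f g : WithConv (C →ₗ[k] A))
    (p : D →ₗc[k] C) :
    toConv ((f * g).ofConv ∘ₗ p.toLinearMap) =
      toConv (f.ofConv ∘ₗ p.toLinearMap) * toConv (g.ofConv ∘ₗ p.toLinearMap) := by
  rw [LinearMap.convMul_comp_coalgHom_distrib]

lemma incl_conv {C : Type*} [AddCommGroup C] [Module k C] [Coalgebra k C]
    (f g : WithConv (C →ₗ[k] R)) :
    toConv ((Algebra.TensorProduct.includeLeft : R →ₐ[k] R ⊗[k] H).toLinearMap ∘ₗ (f * g).ofConv) =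
      toConv ((Algebra.TensorProduct.includeLeft : R →ₐ[k] R ⊗[k] H).toLinearMap ∘ₗ f.ofConv) *
      toConv ((Algebra.TensorProduct.includeLeft : R →ₐ[k] R ⊗[k] H).toLinearMap ∘ₗ g.ofConv) := by
  rw [LinearMap.algHom_comp_convMul_distrib]

/-- The twisted module and cocycle identities combined, in the form used for associativity. -/
lemma twisted_cocycle (b : R) :
    toConv (W.actOn (toConv (mulCounit H (W.act.flip b)) * c.σ.val).ofConv) *
        toConv (c.σ.val.ofConv ∘ₗ (LinearMap.mul' k H).lTensor H) =
      toConv (mulCounit H c.σ.val.ofConv ∘ₗ (assocInv k H).toLinearMap) *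
      (toConv (mulCounit H (W.act.flip b ∘ₗ LinearMap.mul' k H) ∘ₗ (assocInv k H).toLinearMap) *
        toConv (c.σ.val.ofConv ∘ₗ (LinearMap.mul' k H).rTensor H ∘ₗ
          (assocInv k H).toLinearMap)) := by
  rw [actOn_conv, mul_assoc]
  refine (congrArg _ c.cocycle).trans ?_
  have h1 : toConv (W.actOn (toConv (mulCounit H (W.act.flip b))).ofConv) =
      toConv ((toConv (mulCounit H (W.actOn (W.act.flip b)))).ofConv ∘ₗ
        (assocInv k H).toLinearMap) := by
    refine WithConv.ext (TensorProduct.ext_threefold' fun x y z => ?_)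
    change W.act x (counit (R := k) z • _) = counit (R := k) z • W.act x _
    rw [map_smul]
  have h2 : (toConv (W.actOn (W.act.flip b)) * c.σ.val : WithConv (H ⊗[k] H →ₗ[k] R)) =
      c.σ.val * toConv (W.act.flip b ∘ₗ LinearMap.mul' k H) := by
    rw [c.twisted, mul_assoc, c.σ.inv_val, mul_one]
  rw [h1, ← mul_assoc, ← mul_assoc]
  congr 1
  have e1 : toConv (mulCounit H (W.actOn (W.act.flip b))) * toConv (mulCounit H c.σ.val.ofConv) =
      toConv (mulCounit H c.σ.val.ofConv) *
        toConv (mulCounit H (W.act.flip b ∘ₗ LinearMap.mul' k H)) := by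
    have e := mulCounit_conv (H := H) (toConv (W.actOn (W.act.flip b))) c.σ.val
    rw [h2, mulCounit_conv] at e
    exact e.symm
  have e2 := congrArg (fun z => toConv (z.ofConv ∘ₗ (assocInv k H).toLinearMap)) e1
  simp only [comp_conv] at e2
  exact e2

lemma leftMulH_leftMulH (h g : H) (y : R ⊗[k] H) :
    c.leftMulH h (c.leftMulH g y) = c.mulMap (c.cocyclePart (h ⊗ₜ g)) y := by
  induction y with
  | zero => simp
  | add x y hx hy => simp only [map_add, hx, hy]
  | tmul b m =>
    have hL : c.leftMulH g (b ⊗ₜ m) =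
      (toConv (Algebra.TensorProduct.includeLeft.toLinearMap ∘ₗ
          (toConv (mulCounit H (W.act.flip b)) * c.σ.val).ofConv) *
        toConv (Algebra.TensorProduct.includeRight.toLinearMap ∘ₗ (mulCoalgHom k H).toLinearMap) :
        WithConv (H ⊗[k] H →ₗ[k] R ⊗[k] H)) (g ⊗ₜ m) := by
      rw [incl_conv, mul_assoc]
      rfl
    have hR : c.mulMap (c.cocyclePart (h ⊗ₜ g)) (b ⊗ₜ m) =
      (toConv ((Algebra.TensorProduct.includeLeft : R →ₐ[k] R ⊗[k] H).toLinearMap ∘ₗ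
          mulCounit H c.σ.val.ofConv) *
        toConv ((actPart W b * c.cocyclePart).ofConv ∘ₗ
          (CoalgHom.rTensor H (mulCoalgHom k H)).toLinearMap)) ((h ⊗ₜ g) ⊗ₜ m) := by
      rw [mulCounit_conv_tmul, cocyclePart, (ℛ k (h ⊗ₜ[k] g)).convMul_apply, map_sum,
        LinearMap.sum_apply]
      refine Finset.sum_congr rfl fun i _ => ?_
      simp only [LinearMap.comp_apply, AlgHom.toLinearMap_apply, includeLeft_mul]
      rw [Algebra.TensorProduct.includeRight_apply, smul_tmul', smul_eq_mul, mul_one]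
      rfl
    have hA : toConv (Algebra.TensorProduct.includeLeft.toLinearMap ∘ₗ
          W.actOn (toConv (mulCounit H (W.act.flip b)) * c.σ.val).ofConv) *
        toConv (c.cocyclePart.ofConv ∘ₗ (mulCoalgHom k H).toLinearMap.lTensor H) =
      toConv ((toConv ((Algebra.TensorProduct.includeLeft : R →ₐ[k] R ⊗[k] H).toLinearMap ∘ₗ
          mulCounit H c.σ.val.ofConv) *
        toConv ((actPart W b * c.cocyclePart).ofConv ∘ₗ
          (CoalgHom.rTensor H (mulCoalgHom k H)).toLinearMap)).ofConv ∘ₗ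
          (assocInv k H).toLinearMap) := by
      have e1 : toConv (c.cocyclePart.ofConv ∘ₗ (mulCoalgHom k H).toLinearMap.lTensor H) = _ :=
        comp_conv _ _ (CoalgHom.lTensor H (mulCoalgHom k H))
      rw [e1, ← mul_assoc, comp_conv, comp_conv, comp_conv, cocyclePart, comp_conv, comp_conv,
        ← mul_assoc, ← mul_assoc]
      have e2 := congrArg (fun z => toConv
        ((Algebra.TensorProduct.includeLeft : R →ₐ[k] R ⊗[k] H).toLinearMap ∘ₗ z.ofConv)) (c.twisted_cocycle b)
      simp only [incl_conv] at e2
      rw [← mul_assoc] at e2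
      refine congrArg₂ (· * ·) (e2.trans ?_) ?_
      · refine congrArg₂ (· * ·) (congrArg₂ (· * ·) rfl ?_) rfl
        refine WithConv.ext (TensorProduct.ext_threefold' fun x y z => ?_)
        change (counit (R := k) z • W.act (x * y) b) ⊗ₜ[k] (1 : H) = (counit (R := k) z • W.act (x * y) b) ⊗ₜ[k] (1 : H)
        rfl
      · refine WithConv.ext (TensorProduct.ext_threefold' fun x y z => ?_)
        change (1 : R) ⊗ₜ[k] (x * (y * z)) = (1 : R) ⊗ₜ[k] (x * y * z)
        rw [mul_assoc]
    rw [hL, leftMulH_conv, hA, hR]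
    rfl


lemma mulMap_tmul_apply (a : R) (h : H) (y : R ⊗[k] H) :
    c.mulMap (a ⊗ₜ h) y = a • c.leftMulH h y := rfl

lemma mulMap_smul (a : R) (x y : R ⊗[k] H) : c.mulMap (a • x) y = a • c.mulMap x y := by
  induction x with
  | zero => simp
  | add x z hx hz => simp only [smul_add, map_add, LinearMap.add_apply, hx, hz]
  | tmul b h => rw [smul_tmul', mulMap_tmul_apply, mulMap_tmul_apply, smul_eq_mul, mul_smul]

lemma mulMap_assoc (x y z : R ⊗[k] H) :
    c.mulMap (c.mulMap x y) z = c.mulMap x (c.mulMap y z) := by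
  induction x with
  | zero => simp
  | add x x' hx hx' => simp only [map_add, LinearMap.add_apply, hx, hx']
  | tmul a h =>
    induction y with
    | zero => simp
    | add y y' hy hy' => simp only [map_add, LinearMap.add_apply, hy, hy']
    | tmul b g =>
      rw [mulMap_tmul, mulMap_smul, mulMap_tmul_apply c b, mulMap_tmul_apply, leftMulH_smul,
        actPart_mul_tmul, map_sum, LinearMap.sum_apply]
      simp only [mulMap_smul, leftMulH_leftMulH]

lemma conv_one_tmul {A : Type*} [Ring A] [Algebra k A]
    (f g : WithConv (H ⊗[k] H →ₗ[k] A)) (x : H) :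
    (f * g) (1 ⊗ₜ x) = ∑ j ∈ (ℛ k x).index,
      f (1 ⊗ₜ (ℛ k x).left j) * g (1 ⊗ₜ (ℛ k x).right j) := by
  rw [LinearMap.convMul_apply, TensorProduct.comul_tmul, Bialgebra.comul_one, ← (ℛ k x).eq]
  simp [tmul_sum, Algebra.TensorProduct.one_def]

lemma conv_tmul_one {A : Type*} [Ring A] [Algebra k A]
    (f g : WithConv (H ⊗[k] H →ₗ[k] A)) (x : H) :
    (f * g) (x ⊗ₜ 1) = ∑ j ∈ (ℛ k x).index,
      f ((ℛ k x).left j ⊗ₜ 1) * g ((ℛ k x).right j ⊗ₜ 1) := by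
  rw [LinearMap.convMul_apply, TensorProduct.comul_tmul, Bialgebra.comul_one, ← (ℛ k x).eq]
  simp [sum_tmul, Algebra.TensorProduct.one_def]

lemma cocyclePart_one_tmul (g : H) : c.cocyclePart (1 ⊗ₜ g) = (1 : R) ⊗ₜ g := by
  rw [cocyclePart, conv_one_tmul]
  have := congrArg (fun z => (1 : R) ⊗ₜ[k] z) (Coalgebra.sum_counit_smul (ℛ k g))
  simp only [tmul_sum, tmul_smul] at this
  rw [← this]
  refine Finset.sum_congr rfl fun j _ => ?_
  simp only [LinearMap.comp_apply, AlgHom.toLinearMap_apply, includeLeft_mul, c.apply_one_left]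
  simp [Algebra.algebraMap_eq_smul_one]

lemma cocyclePart_tmul_one (h : H) : c.cocyclePart (h ⊗ₜ 1) = (1 : R) ⊗ₜ h := by
  rw [cocyclePart, conv_tmul_one]
  have := congrArg (fun z => (1 : R) ⊗ₜ[k] z) (Coalgebra.sum_counit_smul (ℛ k h))
  simp only [tmul_sum, tmul_smul] at this
  rw [← this]
  refine Finset.sum_congr rfl fun j _ => ?_
  simp only [LinearMap.comp_apply, AlgHom.toLinearMap_apply, includeLeft_mul, c.apply_one_right]
  simp [Algebra.algebraMap_eq_smul_one]

lemma mulMap_one_left (x : R ⊗[k] H) : c.mulMap (1 ⊗ₜ 1) x = x := by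
  rw [mulMap_tmul_apply, one_smul]
  induction x with
  | zero => simp
  | add x y hx hy => rw [map_add, hx, hy]
  | tmul b g =>
    rw [leftMulH_tmul]
    change (actPart W b * c.cocyclePart) (1 ⊗ₜ[k] g) = _
    rw [conv_one_tmul]
    have := congrArg (fun z => b ⊗ₜ[k] z) (Coalgebra.sum_counit_smul (ℛ k g))
    simp only [tmul_sum, tmul_smul] at this
    rw [← this]
    refine Finset.sum_congr rfl fun j _ => ?_
    rw [cocyclePart_one_tmul]
    simp only [actPart, LinearMap.comp_apply, AlgHom.toLinearMap_apply, mulCounit_tmul, map_smul,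
      LinearMap.flip_apply, W.one_act, smul_mul_assoc, includeLeft_mul]
    rw [smul_tmul', smul_eq_mul, mul_one]

lemma mulMap_one_right (x : R ⊗[k] H) : c.mulMap x (1 ⊗ₜ 1) = x := by
  induction x with
  | zero => simp
  | add x y hx hy => rw [map_add, LinearMap.add_apply, hx, hy]
  | tmul a h =>
    rw [mulMap_tmul, actPart_mul_tmul]
    have h1 : a ⊗ₜ[k] h = a • (1 : R) ⊗ₜ[k] h := by rw [smul_tmul', smul_eq_mul, mul_one]
    have := congrArg (fun z => (1 : R) ⊗ₜ[k] z) (Coalgebra.sum_counit_smul (ℛ k h))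
    simp only [tmul_sum, tmul_smul] at this
    rw [h1, ← this]
    refine congrArg _ (Finset.sum_congr rfl fun j _ => ?_)
    rw [cocyclePart_tmul_one, W.act_one, Algebra.algebraMap_eq_smul_one, smul_assoc, one_smul]

end CrossedSystem

/-- The crossed product `R #_σ H`: the vector space `R ⊗ H`, whose elements `a ⊗ h` are written
`a # h`, with the multiplication
`(a # h) (b # g) = ∑ a (h₁ · b) σ(h₂, g₁) # h₃ g₂`. -/
def CrossedProduct {k H R : Type*} [Field k] [Ring H] [Bialgebra k H] [Ring R] [Algebra k R]
    {W : WeakAction k H R} (_c : CrossedSystem W) : Type _ := R ⊗[k] H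

namespace CrossedProduct

variable {k H R : Type*} [Field k] [Ring H] [Bialgebra k H] [Ring R] [Algebra k R]
  {W : WeakAction k H R} (c : CrossedSystem W)

instance : AddCommGroup (CrossedProduct c) := inferInstanceAs (AddCommGroup (R ⊗[k] H))

instance : Ring (CrossedProduct c) where
  __ := (inferInstance : AddCommGroup (CrossedProduct c))
  mul x y := c.mulMap x y
  one := (1 ⊗ₜ[k] 1 : R ⊗[k] H)
  left_distrib x y z := (c.mulMap x).map_add y z
  right_distrib x y z := c.mulMap.map_add₂ x y z
  zero_mul y := c.mulMap.map_zero₂ y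
  mul_zero x := (c.mulMap x).map_zero
  mul_assoc x y z := c.mulMap_assoc x y z
  one_mul x := c.mulMap_one_left x
  mul_one x := c.mulMap_one_right x

/-- The subspace `I #_σ H` of `R #_σ H`, the image of `I ⊗ H` in `R ⊗ H`, as a set. -/
def ofIdeal (I : Ideal R) : Set (CrossedProduct c) :=
  SetLike.coe (LinearMap.range ((I.restrictScalars k).subtype.rTensor H) : Submodule k (R ⊗[k] H))

end CrossedProduct

end

/-! An inner action sends `a` to a sum of terms `u(h₁) a u⁻¹(h₂)`, so every two-sided ideal of `R`
is an `H`-ideal. Prime ideals are therefore `H`-semiprime and `H`-semiprime ideals are semiprime,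
which gives part (1) (`IsInner.hBaerRadical_eq`, `IsInner.baerRadicalH_eq`).

For part (2) write `A` for the crossed product, `N` for the Baer radical of `R` and `γ(h) = 1 # h`.
A prime ideal of `A` contracts to a prime ideal of `R`, again because all ideals of `R` are
`H`-ideals; hence it contains `N # H` (`hIdeal_baerRadical_le`).

For the other inclusion it suffices that `N # H` is semiprime, since the Baer radical lies in every
semiprime ideal (`IsSemiprimeIdeal.baerRadical_le`). Two facts about `A` are used. Innerness makes
the elements `∑ u⁻¹(h₁) # h₂`, with `h` in a basis of `H`, a free `R`-basis of `A` centralizing `R`.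
Semisimplicity gives a right integral `t` with `ε(t) = 1`; as `γ` is convolution invertible
(`genInv_mul_gen`, `gen_mul_genInv`), `∑ γ⁻¹(t₁) ⊗ γ(t₂)` is a Casimir element over `R` with product
`1` (`casimir_comm`, `mul'_casimir`), so `A` is in effect separable over `R`.

Both facts pass to `A / (N # H)`, where `eq_zero_of_mul_eq_zero_of_casimir` applies. It is an
essential form of Maschke's theorem: an ideal `I` with `I² = 0` has a sub-bimodule `K` with `I ⊕ K`
essential, and averaging the partially defined projection onto `I` shows that `I` is annihilated by
an essential part of `R`. Freeness and semiprimeness of `R / N` then force `I = 0`. -/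

noncomputable section

/-! ### Prime and semiprime ideals of noncommutative rings -/

section Radical

variable {A : Type*} [Ring A]

/-- A two-sided ideal `Q` is semiprime if every two-sided ideal with square in `Q` is contained
in `Q`. -/
structure IsSemiprimeIdeal (Q : Ideal A) : Prop where
  isTwoSided : Q.IsTwoSided
  le_of_mul_self_le : ∀ J : Ideal A, J.IsTwoSided → J * J ≤ Q → J ≤ Q

lemma isTwoSided_sup {I J : Ideal A} (hI : I.IsTwoSided) (hJ : J.IsTwoSided) :
    (I ⊔ J).IsTwoSided := by
  refine ⟨fun b ha => ?_⟩
  obtain ⟨x, hx, y, hy, rfl⟩ := Submodule.mem_sup.1 ha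
  rw [add_mul]
  exact Submodule.add_mem_sup (Ideal.mul_mem_right b I hx) (Ideal.mul_mem_right b J hy)

lemma isTwoSided_sInf {S : Set (Ideal A)} (hS : ∀ I ∈ S, I.IsTwoSided) : (sInf S).IsTwoSided := by
  refine ⟨fun b ha => ?_⟩
  rw [Submodule.mem_sInf] at ha ⊢
  intro I hI
  have := hS I hI
  exact Ideal.mul_mem_right b I (ha I hI)

/-- The two-sided ideal generated by `x`. -/
def principalIdeal (x : A) : Ideal A := Ideal.span (Set.range fun r => x * r)

lemma principalIdeal_isTwoSided (x : A) : (principalIdeal x).IsTwoSided := by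
  refine ⟨fun b ha => ?_⟩
  refine Submodule.span_induction (p := fun a _ => a * b ∈ principalIdeal x) ?_ ?_ ?_ ?_ ha
  · rintro _ ⟨r, rfl⟩
    exact Ideal.subset_span ⟨r * b, (mul_assoc x r b).symm⟩
  · simp
  · intro y z _ _ hy hz
    rw [add_mul]
    exact add_mem hy hz
  · intro c y _ hy
    rw [smul_eq_mul, mul_assoc]
    exact Ideal.mul_mem_left _ c hy

lemma self_mem_principalIdeal (x : A) : x ∈ principalIdeal x :=
  Ideal.subset_span ⟨1, mul_one x⟩

lemma principalIdeal_mul_self_le {Q : Ideal A} (hQ : Q.IsTwoSided) {x : A}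
    (hx : ∀ r, x * r * x ∈ Q) : principalIdeal x * principalIdeal x ≤ Q := by
  refine Ideal.mul_le.2 fun a ha b hb => ?_
  have hb' : ∀ r, x * r * b ∈ Q := by
    refine Submodule.span_induction (p := fun b _ => ∀ r, x * r * b ∈ Q) ?_ ?_ ?_ ?_ hb
    · rintro _ ⟨s, rfl⟩ r
      rw [← mul_assoc]
      exact Q.mul_mem_right _ (hx r)
    · simp
    · intro y z _ _ hy hz r
      rw [mul_add]
      exact add_mem (hy r) (hz r)
    · intro c y _ hy r
      have := hy (r * c)
      rwa [smul_eq_mul, ← mul_assoc, mul_assoc x r c]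
  refine Submodule.span_induction (p := fun a _ => a * b ∈ Q) ?_ ?_ ?_ ?_ ha
  · rintro _ ⟨s, rfl⟩
    exact hb' s
  · simp
  · intro y z _ _ hy hz
    rw [add_mul]
    exact add_mem hy hz
  · intro c y _ hy
    rw [smul_eq_mul, mul_assoc]
    exact Q.mul_mem_left c hy

/-- The prime ideal avoidance theorem for `m`-systems which are given by a sequence. -/
lemma exists_isPrimeIdeal_of_seq {Q : Ideal A} (hQ : Q.IsTwoSided) (x : ℕ → A)
    (hx : ∀ n, x n ∉ Q) (hsucc : ∀ n, ∃ r, x (n + 1) = x n * r * x n) :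
    ∃ P : Ideal A, IsPrimeIdeal P ∧ x 0 ∉ P := by
  have step : ∀ I : Ideal A, I.IsTwoSided → ∀ n m, n ≤ m → x n ∈ I → x m ∈ I := by
    intro I _ n m hnm hn
    induction m, hnm using Nat.le_induction with
    | base => exact hn
    | succ m _ ih =>
      obtain ⟨r, hr⟩ := hsucc m
      rw [hr]
      exact I.mul_mem_left _ ih
  obtain ⟨P, hQP, hP⟩ := zorn_le_nonempty₀
    {J : Ideal A | J.IsTwoSided ∧ ∀ n, x n ∉ J} (fun c hc hchain y hy => by
      refine ⟨sSup c, ⟨⟨fun b ha => ?_⟩, fun n hn => ?_⟩, fun z hz => le_sSup hz⟩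
      · rw [Submodule.mem_sSup_of_directed ⟨y, hy⟩ hchain.directedOn] at ha ⊢
        obtain ⟨J, hJ, haJ⟩ := ha
        have := (hc hJ).1
        exact ⟨J, hJ, Ideal.mul_mem_right b J haJ⟩
      · rw [Submodule.mem_sSup_of_directed ⟨y, hy⟩ hchain.directedOn] at hn
        obtain ⟨J, hJ, hnJ⟩ := hn
        exact (hc hJ).2 n hnJ) Q ⟨hQ, hx⟩
  have hP2 := hP.prop.1
  -- By maximality of `P`, every strictly larger two-sided ideal contains a term of the sequence.
  have meet : ∀ I : Ideal A, I.IsTwoSided → ¬ I ≤ P → ∃ n, x n ∈ P ⊔ I := by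
    intro I hI hIP
    by_contra! h
    exact hIP (le_sup_right.trans (hP.2 ⟨isTwoSided_sup hP2 hI, h⟩ le_sup_left))
  refine ⟨P, ⟨hP2, fun h => hP.prop.2 0 (h ▸ Submodule.mem_top), fun I J hI hJ hIJ => ?_⟩,
    hP.prop.2 0⟩
  by_contra! h
  obtain ⟨n, hn⟩ := meet I hI h.1
  obtain ⟨m, hm⟩ := meet J hJ h.2
  have h1 := step _ (isTwoSided_sup hP2 hI) n (max n m) (le_max_left _ _) hn
  have h2 := step _ (isTwoSided_sup hP2 hJ) m (max n m) (le_max_right _ _) hm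
  -- From index `max n m` on, the sequence lies in both `P ⊔ I` and `P ⊔ J`; the next term is a
  -- product across the two, hence in `P`.
  obtain ⟨r, hr⟩ := hsucc (max n m)
  refine hP.prop.2 (max n m + 1) ?_
  have := isTwoSided_sup hP2 hI
  have h3 := Ideal.mul_mem_mul ((P ⊔ I).mul_mem_right r h1) h2
  rw [hr]
  refine (?_ : (P ⊔ I) * (P ⊔ J) ≤ P) h3
  rw [Ideal.sup_mul, Ideal.mul_sup, Ideal.mul_sup]
  exact sup_le (sup_le Ideal.mul_le_right Ideal.mul_le_left) (sup_le Ideal.mul_le_right hIJ)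

/-- For `y ∉ Q`, semiprimeness gives `r` with `y r y ∉ Q`. Iterating from a given `x ∉ Q` produces a
sequence avoiding `Q`, and so a prime ideal that misses `x`. -/
lemma IsSemiprimeIdeal.baerRadical_le {Q : Ideal A} (hQ : IsSemiprimeIdeal Q) :
    baerRadical A ≤ Q := by
  intro x hx
  by_contra hxQ
  have key : ∀ y : {y : A // y ∉ Q}, ∃ r, y.1 * r * y.1 ∉ Q := by
    rintro ⟨y, hy⟩
    by_contra! h
    exact hy (hQ.le_of_mul_self_le _ (principalIdeal_isTwoSided y)
      (principalIdeal_mul_self_le hQ.isTwoSided h) (self_mem_principalIdeal y))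
  choose r hr using key
  let s : ℕ → {y : A // y ∉ Q} := fun n => Nat.rec ⟨x, hxQ⟩ (fun _ y => ⟨_, hr y⟩) n
  obtain ⟨P, hP, hxP⟩ := exists_isPrimeIdeal_of_seq hQ.isTwoSided (fun n => (s n).1)
    (fun n => (s n).2) (fun n => ⟨r (s n), rfl⟩)
  exact hxP (Submodule.mem_sInf.1 hx P hP)

lemma baerRadical_isSemiprimeIdeal : IsSemiprimeIdeal (baerRadical A) where
  isTwoSided := isTwoSided_sInf fun _ hP => hP.isTwoSided
  le_of_mul_self_le J hJ h := le_sInf fun _ hP =>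
    (hP.le_or_le J J hJ hJ (h.trans (sInf_le hP))).elim id id

lemma IsPrimeIdeal.le_of_pow_le {P J : Ideal A} (hP : IsPrimeIdeal P) (hJ : J.IsTwoSided) (n : ℕ)
    (h : J ^ n ≤ P) : J ≤ P := by
  induction n with
  -- `J ^ 0` is the whole ring, so this case contradicts properness of `P`.
  | zero => exact (hP.ne_top (top_le_iff.1 (by simpa [Submodule.pow_zero] using h))).elim
  | succ n ih =>
    rw [Ideal.IsTwoSided.pow_succ] at h
    exact (hP.le_or_le J (J ^ n) hJ inferInstance h).elim id ih

end Radical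

/-! ### Ideals under an inner action -/

namespace WeakAction

variable {k H R : Type*} [Field k] [Ring H] [Bialgebra k H] [Ring R] [Algebra k R]
  {W : WeakAction k H R}

/-- Each term `u(h₁) a u⁻¹(h₂)` already lies in the two-sided ideal generated by `a`. -/
lemma IsInner.isHIdeal (hW : W.IsInner) {I : Ideal R} (hI : I.IsTwoSided) : W.IsHIdeal I := by
  refine ⟨hI, fun h a ha => ?_⟩
  obtain ⟨u, hu⟩ := hW
  rw [hu, ← (ℛ k h).eq]
  simp only [map_sum, TensorProduct.map_tmul, LinearMap.mul'_apply, LinearMap.comp_apply,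
    LinearMap.mulRight_apply]
  exact sum_mem fun i _ => I.mul_mem_right _ (I.mul_mem_left _ ha)

lemma IsInner.hBaerRadical_eq (hW : W.IsInner) : W.hBaerRadical = baerRadical R := by
  refine le_antisymm (sInf_le_sInf fun P hP => ?_) (le_sInf fun I hI => ?_)
  · exact ⟨hW.isHIdeal hP.isTwoSided, fun J hJ n h => hP.le_of_pow_le hJ.isTwoSided n h⟩
  · refine IsSemiprimeIdeal.baerRadical_le ⟨hI.isHIdeal.isTwoSided, fun J hJ h => ?_⟩
    exact hI.le_of_pow_le J (hW.isHIdeal hJ) 2 (by rwa [Ideal.IsTwoSided.pow_succ,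
      Submodule.pow_one])

lemma IsInner.baerRadicalH_eq (hW : W.IsInner) : W.baerRadicalH = baerRadical R := by
  refine le_antisymm (fun a ha => ?_) fun a ha h =>
    (hW.isHIdeal baerRadical_isSemiprimeIdeal.isTwoSided).act_mem h a ha
  have := ha 1
  rwa [W.one_act] at this

end WeakAction

/-! ### An essential Maschke theorem -/

section Subbimodule

variable {R A : Type*} [Ring R] [Ring A] {ι : R →+* A}

/-- The sub-bimodules of `A`, as a bimodule over `R` through `ι : R → A`. -/
structure IsSubbimodule (ι : R →+* A) (M : AddSubgroup A) : Prop where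
  map_mul_mem : ∀ r, ∀ x ∈ M, ι r * x ∈ M
  mul_map_mem : ∀ r, ∀ x ∈ M, x * ι r ∈ M

lemma IsSubbimodule.sup {M N : AddSubgroup A} (hM : IsSubbimodule ι M) (hN : IsSubbimodule ι N) :
    IsSubbimodule ι (M ⊔ N) := by
  constructor
  · intro r x hx
    obtain ⟨y, hy, z, hz, rfl⟩ := AddSubgroup.mem_sup.1 hx
    rw [mul_add]
    exact add_mem (AddSubgroup.mem_sup_left (hM.map_mul_mem r y hy))
      (AddSubgroup.mem_sup_right (hN.map_mul_mem r z hz))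
  · intro r x hx
    obtain ⟨y, hy, z, hz, rfl⟩ := AddSubgroup.mem_sup.1 hx
    rw [add_mul]
    exact add_mem (AddSubgroup.mem_sup_left (hM.mul_map_mem r y hy))
      (AddSubgroup.mem_sup_right (hN.mul_map_mem r z hz))

lemma exists_maximal_subbimodule_disjoint (ι : R →+* A) (I : AddSubgroup A) :
    ∃ K, Maximal (fun K => IsSubbimodule ι K ∧ Disjoint I K) K := by
  obtain ⟨K, -, hK⟩ := zorn_le_nonempty₀
    {K : AddSubgroup A | IsSubbimodule ι K ∧ Disjoint I K} (fun c hc hchain y hy => by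
      have mem {x : A} : x ∈ sSup c ↔ ∃ J ∈ c, x ∈ J :=
        AddSubgroup.mem_sSup_of_directedOn ⟨y, hy⟩ hchain.directedOn
      refine ⟨sSup c, ⟨⟨fun r x hx => ?_, fun r x hx => ?_⟩, ?_⟩, fun z hz => le_sSup hz⟩
      · obtain ⟨J, hJ, hx⟩ := mem.1 hx
        exact mem.2 ⟨J, hJ, (hc hJ).1.map_mul_mem r x hx⟩
      · obtain ⟨J, hJ, hx⟩ := mem.1 hx
        exact mem.2 ⟨J, hJ, (hc hJ).1.mul_map_mem r x hx⟩
      · rw [AddSubgroup.disjoint_def]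
        intro x hxI hx
        obtain ⟨J, hJ, hx⟩ := mem.1 hx
        exact AddSubgroup.disjoint_def.1 (hc hJ).2 hxI hx) ⊥
    ⟨⟨fun r x hx => by simp_all, fun r x hx => by simp_all⟩, disjoint_bot_right⟩
  exact ⟨K, hK⟩

/-- A complement which is maximal with trivial intersection gives an essential sum. -/
lemma exists_mem_sup_of_maximal {I K : AddSubgroup A}
    (hK : Maximal (fun K => IsSubbimodule ι K ∧ Disjoint I K) K) {L : AddSubgroup A}
    (hL : IsSubbimodule ι L) (hL0 : L ≠ ⊥) : ∃ x ∈ L, x ≠ 0 ∧ x ∈ I ⊔ K := by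
  by_contra! h
  -- If `L` met `I ⊔ K` only in zero, `K` could be enlarged by `L` without meeting `I`.
  have hdisj : Disjoint I (K ⊔ L) := by
    rw [AddSubgroup.disjoint_def]
    intro x hxI hx
    obtain ⟨y, hy, z, hz, rfl⟩ := AddSubgroup.mem_sup.1 hx
    have hz' : z ∈ I ⊔ K := by
      have := add_mem (AddSubgroup.mem_sup_left (T := K) hxI)
        (AddSubgroup.mem_sup_right (S := I) (neg_mem hy))
      rwa [add_neg_cancel_comm] at this
    have hz0 : z = 0 := by
      by_contra hz0
      exact h z hz hz0 hz'
    rw [hz0, add_zero] at hxI ⊢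
    exact AddSubgroup.disjoint_def.1 hK.prop.2 hxI hy
  have hLK : L ≤ K := le_sup_right.trans (hK.2 ⟨hK.prop.1.sup hL, hdisj⟩ le_sup_left)
  refine hL0 ((AddSubgroup.eq_bot_iff_forall L).2 fun x hx => ?_)
  by_contra hx0
  exact h x hx hx0 (AddSubgroup.mem_sup_right (hLK hx))

/-- The projection of `I ⊕ K` onto `I` composed with an additive map into `I ⊕ K`. -/
lemma exists_proj_comp {B : Type*} [AddCommGroup B] {I K : AddSubgroup A} (hIK : Disjoint I K)
    (f : B →+ A) (hf : ∀ b, f b ∈ I ⊔ K) :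
    ∃ g : B →+ A, (∀ b, g b ∈ I) ∧ ∀ b, f b - g b ∈ K := by
  choose g hg k hk hgk using fun b => AddSubgroup.mem_sup.1 (hf b)
  refine ⟨AddMonoidHom.mk' g fun a b => ?_, hg, fun b => ?_⟩
  -- The defect of additivity lies in `I` by its left expression and in `K` by its right one.
  · have h : g (a + b) - (g a + g b) = k a + k b - k (a + b) := by
      have h1 := hgk (a + b)
      rw [map_add, ← hgk a, ← hgk b] at h1
      rw [sub_eq_sub_iff_add_eq_add, h1]
      abel
    exact sub_eq_zero.1 (AddSubgroup.disjoint_def.1 hIK (sub_mem (hg _) (add_mem (hg a) (hg b)))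
      (h ▸ sub_mem (add_mem (hk a) (hk b)) (hk _)))
  · rw [← hgk b]
    simpa using hk b

/-- Let `A` be a free extension of (the image of) a semiprime ring `R`, with a finite basis `v`
which centralizes `R`, and suppose that there is a Casimir element `∑ p j ⊗ q j` in `A ⊗ A`,
balanced over `R`, with `∑ p j * q j = 1`. Then `A` is semiprime. -/
theorem eq_zero_of_mul_eq_zero_of_casimir (hN : IsSemiprimeIdeal (RingHom.ker ι))
    {n m : Type*} [Fintype n] [Fintype m] (v : n → A) (hv : ∀ i r, v i * ι r = ι r * v i)
    (hspan : ∀ x, ∃ a : n → R, x = ∑ i, ι (a i) * v i)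
    (hfree : ∀ a : n → R, ∑ i, ι (a i) * v i = 0 → ∀ i, ι (a i) = 0)
    (p q : m → A) (hpq : ∑ j, p j * q j = 1)
    (hcas : ∀ g : A →+ A, (∀ r x, g (ι r * x) = ι r * g x) →
      ∀ a, ∑ j, p j * g (q j * a) = a * ∑ j, p j * g (q j))
    (I : Ideal A) (hI2 : I.IsTwoSided) (hI : ∀ x ∈ I, ∀ y ∈ I, x * y = 0) : I = ⊥ := by
  classical
  have hIb : IsSubbimodule ι I.toAddSubgroup :=
    ⟨fun r x hx => I.mul_mem_left _ hx, fun r x hx => Ideal.mul_mem_right _ I hx⟩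
  obtain ⟨K, hK⟩ := exists_maximal_subbimodule_disjoint ι I.toAddSubgroup
  have hM := hIb.sup hK.prop.1
  set M := I.toAddSubgroup ⊔ K with hMdef
  -- Since the `v i` centralize `R` and span, `u ∈ U` gives `A * ι u ⊆ M`, so right multiplication
  -- by `ι u` can be followed by the projection of `M` onto `I`.
  let U : Set R := {a | ∀ i, ι a * v i ∈ M}
  have hIU : ∀ z ∈ I, ∀ u ∈ U, z * ι u = 0 := by
    intro z hz u hu
    have hAu : ∀ y, y * ι u ∈ M := by
      intro y
      obtain ⟨a, rfl⟩ := hspan y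
      rw [Finset.sum_mul]
      refine sum_mem fun i _ => ?_
      rw [mul_assoc, hv]
      exact hM.map_mul_mem _ _ (hu i)
    obtain ⟨g, hgI, hgK⟩ := exists_proj_comp hK.prop.2 (AddMonoidHom.mulRight (ι u)) hAu
    have huniq : ∀ x ∈ I, x ∈ K → x = 0 := fun x h1 h2 =>
      AddSubgroup.disjoint_def.1 hK.prop.2 h1 h2
    have hglin : ∀ r x, g (ι r * x) = ι r * g x := by
      intro r x
      refine (sub_eq_zero.1 (huniq _ (sub_mem (I.mul_mem_left _ (hgI x)) (hgI _)) ?_)).symm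
      have := sub_mem (hgK (ι r * x)) (hK.prop.1.map_mul_mem r _ (hgK x))
      simpa [mul_sub, mul_assoc] using this
    have hgid : ∀ x ∈ I, g x = x * ι u := by
      intro x hx
      exact (sub_eq_zero.1 (huniq _ (sub_mem (Ideal.mul_mem_right _ I hx) (hgI x)) (hgK x))).symm
    -- For `z ∈ I` the Casimir identity equates `∑ p j * g (q j * z) = z * ι u` with `z * ∑ p j * g
    -- (q j)`, which lies in `I * I = 0`.
    have h := hcas g hglin z
    rw [hI z hz _ (sum_mem fun j _ => I.mul_mem_left _ (hgI _))] at h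
    rw [← h, ← one_mul (z * ι u), ← hpq, Finset.sum_mul]
    refine Finset.sum_congr rfl fun j _ => ?_
    rw [hgid _ (I.mul_mem_left _ hz)]
    simp only [mul_assoc]
  -- `U` is essential: a nonzero ideal of the image of `R` meets it nontrivially. Basis indices are
  -- imposed one at a time.
  have hUess : ∀ L : Ideal R, L.IsTwoSided → ¬ L ≤ RingHom.ker ι → ∀ s : Finset n,
      ∃ a ∈ L, ι a ≠ 0 ∧ ∀ i ∈ s, ι a * v i ∈ M := by
    intro L hL hLN s
    induction s using Finset.induction_on with
    | empty =>
      obtain ⟨a, ha, h⟩ := SetLike.not_le_iff_exists.1 hLN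
      exact ⟨a, ha, h, by simp⟩
    | insert i s _ ih =>
      obtain ⟨a, ha, ha0, has⟩ := ih
      by_cases h : ∀ b ∈ L, (∀ i ∈ s, ι b * v i ∈ M) → ι b * v i = 0
      · refine ⟨a, ha, ha0, fun j hj => ?_⟩
        rcases Finset.mem_insert.1 hj with rfl | hj
        · rw [h a ha has]
          exact zero_mem M
        · exact has j hj
      push Not at h
      -- If the elements of `L` admissible for `s` are not all killed by `v i`, their products with
      -- `v i` form a nonzero sub-bimodule, which must meet the essential sum `M`.
      let T : AddSubgroup A :=
        { carrier := {x | ∃ b ∈ L, (∀ i ∈ s, ι b * v i ∈ M) ∧ x = ι b * v i}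
          zero_mem' := ⟨0, zero_mem L, fun _ _ => by simp, by simp⟩
          add_mem' := by
            rintro _ _ ⟨b, hb, hbs, rfl⟩ ⟨d, hd, hds, rfl⟩
            refine ⟨b + d, add_mem hb hd, fun j hj => ?_, by rw [map_add, add_mul]⟩
            rw [map_add, add_mul]
            exact add_mem (hbs j hj) (hds j hj)
          neg_mem' := by
            rintro _ ⟨b, hb, hbs, rfl⟩
            refine ⟨-b, neg_mem hb, fun j hj => ?_, by rw [map_neg, neg_mul]⟩
            rw [map_neg, neg_mul]
            exact neg_mem (hbs j hj) }
      have hT : IsSubbimodule ι T := by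
        constructor
        · rintro r _ ⟨b, hb, hbs, rfl⟩
          refine ⟨r * b, L.mul_mem_left _ hb, fun j hj => ?_, by rw [map_mul, mul_assoc]⟩
          rw [map_mul, mul_assoc]
          exact hM.map_mul_mem _ _ (hbs j hj)
        · rintro r _ ⟨b, hb, hbs, rfl⟩
          refine ⟨b * r, Ideal.mul_mem_right _ L hb, fun j hj => ?_, by
            rw [map_mul, mul_assoc, hv, mul_assoc]⟩
          rw [map_mul, mul_assoc, ← hv, ← mul_assoc]
          exact hM.mul_map_mem _ _ (hbs j hj)
      have hT0 : T ≠ ⊥ := by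
        obtain ⟨b, hb, hbs, hb0⟩ := h
        intro h0
        have : ι b * v i ∈ T := ⟨b, hb, hbs, rfl⟩
        rw [h0] at this
        exact hb0 (AddSubgroup.mem_bot.1 this)
      obtain ⟨_, ⟨b, hb, hbs, rfl⟩, hb0, hbM⟩ := exists_mem_sup_of_maximal hK hT hT0
      refine ⟨b, hb, fun h0 => hb0 (by rw [h0, zero_mul]), fun j hj => ?_⟩
      rcases Finset.mem_insert.1 hj with rfl | hj
      · exact hbM
      · exact hbs j hj
  have hU2 : ∀ u ∈ U, ∀ r, r * u ∈ U := fun u hu r i => by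
    rw [map_mul, mul_assoc]
    exact hM.map_mul_mem _ _ (hu i)
  -- The left annihilator of `U` modulo `ker ι`. Were it not inside `ker ι`, it would share with `U`
  -- some `a` with `ι a ≠ 0`; then `a R a ⊆ ker ι`, against semiprimeness.
  let L : Ideal R :=
    { carrier := {a | ∀ u ∈ U, ι (a * u) = 0}
      zero_mem' := fun u _ => by simp
      add_mem' := fun {a b} ha hb u hu => by rw [add_mul, map_add, ha u hu, hb u hu, add_zero]
      smul_mem' := fun c a ha u hu => by
        rw [smul_eq_mul, mul_assoc, map_mul, ha u hu, mul_zero] }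
  have hL : L.IsTwoSided := ⟨fun b ha u hu => by rw [mul_assoc]; exact ha _ (hU2 u hu b)⟩
  have hLN : L ≤ RingHom.ker ι := by
    by_contra hLN
    have hU' : ∀ a, (∀ i ∈ (Finset.univ : Finset n), ι a * v i ∈ M) → a ∈ U :=
      fun a ha i => ha i (Finset.mem_univ i)
    obtain ⟨a, haL, ha0, haU⟩ := hUess L hL hLN Finset.univ
    refine ha0 (hN.le_of_mul_self_le _ (principalIdeal_isTwoSided a)
      (principalIdeal_mul_self_le hN.isTwoSided fun r => ?_) (self_mem_principalIdeal a))
    exact Ideal.mul_mem_right r L haL a (hU' a haU)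
  rw [eq_bot_iff]
  intro z hz
  obtain ⟨a, rfl⟩ := hspan z
  -- Multiplying `z` by `ι u` multiplies each coefficient by `u`, so by freeness all coefficients
  -- annihilate `U`.
  have hz0 : ∀ i, ι (a i) = 0 := by
    intro i
    refine hLN fun u hu => ?_
    refine hfree (fun i => a i * u) ?_ i
    rw [← hIU _ hz u hu, Finset.sum_mul]
    refine Finset.sum_congr rfl fun j _ => ?_
    rw [map_mul, mul_assoc, mul_assoc, hv]
  simp [hz0]

end Subbimodule

/-! ### Sweedler calculus as words in convolution algebras -/

section Convolution

variable {k : Type*} [Field k]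

/-- Composition with an algebra homomorphism as a homomorphism of convolution algebras. -/
def convMap {A B : Type*} (C : Type*) [Semiring A] [Algebra k A] [Semiring B] [Algebra k B]
    [AddCommGroup C] [Module k C] [Coalgebra k C] (φ : A →ₐ[k] B) :
    WithConv (C →ₗ[k] A) →+* WithConv (C →ₗ[k] B) where
  toFun f := toConv (φ.toLinearMap ∘ₗ f.ofConv)
  map_one' := by
    refine WithConv.ext (LinearMap.ext fun x => ?_)
    simp [LinearMap.convOne_def]
  map_mul' f g := by rw [LinearMap.algHom_comp_convMul_distrib]
  map_zero' := by
    refine WithConv.ext (LinearMap.ext fun x => ?_)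
    simp
  map_add' f g := by
    refine WithConv.ext (LinearMap.ext fun x => ?_)
    simp

/-- Composition with a coalgebra homomorphism as a homomorphism of convolution algebras. -/
def convComap {C D : Type*} (A : Type*) [Ring A] [Algebra k A] [AddCommGroup C] [Module k C]
    [Coalgebra k C] [AddCommGroup D] [Module k D] [Coalgebra k D] (p : D →ₗc[k] C) :
    WithConv (C →ₗ[k] A) →+* WithConv (D →ₗ[k] A) where
  toFun f := toConv (f.ofConv ∘ₗ p.toLinearMap)
  map_one' := by
    refine WithConv.ext (LinearMap.ext fun x => ?_)
    simp [LinearMap.convOne_def]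
  map_mul' f g := by rw [LinearMap.convMul_comp_coalgHom_distrib]
  map_zero' := by
    refine WithConv.ext (LinearMap.ext fun x => ?_)
    simp
  map_add' f g := by
    refine WithConv.ext (LinearMap.ext fun x => ?_)
    simp

section Projections

variable (C D : Type*) [AddCommGroup C] [Module k C] [Coalgebra k C]
  [AddCommGroup D] [Module k D] [Coalgebra k D]

variable (k) in
/-- The projection `c ⊗ d ↦ ε(d) c`. -/
def coalgFst : C ⊗[k] D →ₗc[k] C :=
  (Coalgebra.TensorProduct.rid k k C : C ⊗[k] k →ₗc[k] C).comp
    (Coalgebra.TensorProduct.map (CoalgHom.id k C) (counitCoalgHom k D))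

variable (k) in
/-- The projection `c ⊗ d ↦ ε(c) d`. -/
def coalgSnd : C ⊗[k] D →ₗc[k] D :=
  (Coalgebra.TensorProduct.lid k D : k ⊗[k] D →ₗc[k] D).comp
    (Coalgebra.TensorProduct.map (counitCoalgHom k C) (CoalgHom.id k D))

variable {C D}

@[simp] lemma coalgFst_tmul (x : C) (y : D) :
    coalgFst k C D (x ⊗ₜ y) = counit (R := k) y • x := rfl

@[simp] lemma coalgSnd_tmul (x : C) (y : D) :
    coalgSnd k C D (x ⊗ₜ y) = counit (R := k) x • y := rfl

lemma sum_counit_right_smul {x : C} {κ : Type*} (r : Coalgebra.Repr k x κ) :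
    ∑ i ∈ r.index, counit (R := k) (r.right i) • r.left i = x := by
  simpa only [map_sum, TensorProduct.rid_tmul, one_smul]
    using congrArg (TensorProduct.rid k C) (sum_tmul_counit_eq (R := k) r)

variable {A : Type*} [Ring A] [Algebra k A]

/-- Counits absorb the superfluous legs. Products of functions of separate variables thereby become
convolution products on `C ⊗ D` and can be manipulated associatively. -/
lemma conv_fst_snd (f : WithConv (C →ₗ[k] A)) (g : WithConv (D →ₗ[k] A)) :
    convComap A (coalgFst k C D) f * convComap A (coalgSnd k C D) g =
      toConv (LinearMap.mul' k A ∘ₗ TensorProduct.map f.ofConv g.ofConv) := by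
  refine WithConv.ext (TensorProduct.ext' fun x y => ?_)
  refine (CrossedSystem.conv_tmul _ _ x y).trans ?_
  change _ = f.ofConv x * g.ofConv y
  conv_rhs => rw [← sum_counit_right_smul (ℛ k x), ← sum_counit_smul (ℛ k y)]
  rw [map_sum, map_sum, Finset.sum_mul_sum]
  refine Finset.sum_congr rfl fun i _ => Finset.sum_congr rfl fun j _ => ?_
  change f.ofConv (counit (R := k) _ • _) * g.ofConv (counit (R := k) _ • _) = _
  simp only [map_smul, smul_mul_smul_comm, mul_comm]
  rfl

lemma map_comp_comul {A B : Type*} [Ring A] [Algebra k A] [Ring B] [Algebra k B]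
    (f : C →ₗ[k] A) (g : C →ₗ[k] B) :
    toConv (TensorProduct.map f g ∘ₗ comul) =
      convMap C (Algebra.TensorProduct.includeLeft : A →ₐ[k] A ⊗[k] B) (toConv f) *
        convMap C Algebra.TensorProduct.includeRight (toConv g) := by
  refine WithConv.ext (LinearMap.ext fun x => ?_)
  refine Eq.trans ?_ ((ℛ k x).convMul_apply _ _).symm
  simp [← (ℛ k x).eq, convMap]

end Projections

section Hopf

variable (k) (H : Type*) [Ring H] [HopfAlgebra k H]

/-- The antipode in a convolution algebra. -/
abbrev convAntipode : WithConv (H →ₗ[k] H) := toConv (HopfAlgebra.antipode k)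

/-- The identity in a convolution algebra. -/
abbrev convId : WithConv (H →ₗ[k] H) := toConv LinearMap.id

variable {k H} {B : Type*} [Ring B] [Algebra k B]

lemma convMap_antipode_mul_id (φ : H →ₐ[k] B) :
    convMap H φ (convAntipode k H) * convMap H φ (convId k H) = 1 := by
  rw [← map_mul, LinearMap.antipode_mul_id, map_one]

lemma convMap_id_mul_antipode (φ : H →ₐ[k] B) :
    convMap H φ (convId k H) * convMap H φ (convAntipode k H) = 1 := by
  rw [← map_mul, LinearMap.id_mul_antipode, map_one]

/-- Composing an algebra homomorphism with the antipode gives its convolution inverse; inverses are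
unique and reverse products. -/
lemma convMap_antipode_of_mul {φ a b : H →ₐ[k] B}
    (h : convMap H φ (convId k H) = convMap H a (convId k H) * convMap H b (convId k H)) :
    convMap H φ (convAntipode k H) =
      convMap H b (convAntipode k H) * convMap H a (convAntipode k H) := by
  refine left_inv_eq_right_inv (convMap_antipode_mul_id φ) ?_
  rw [h, mul_assoc, ← mul_assoc (convMap H b _), convMap_id_mul_antipode, one_mul,
    convMap_id_mul_antipode]

variable (k H) in
/-- The map `h ↦ ∑ S(h₁) ⊗ h₂`. -/
def antipodeTmul : H →ₗ[k] H ⊗[k] H := (HopfAlgebra.antipode k).rTensor H ∘ₗ comul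

variable (k H) in
/-- The map `h ↦ ∑ h₁ ⊗ (S(h₂) ⊗ h₃)`. -/
def tmulAntipodeTmul : H →ₗ[k] H ⊗[k] (H ⊗[k] H) := (antipodeTmul k H).lTensor H ∘ₗ comul

open Algebra.TensorProduct in
lemma toConv_antipodeTmul : toConv (antipodeTmul k H) =
    convMap H includeLeft (convAntipode k H) * convMap H includeRight (convId k H) :=
  map_comp_comul _ _

variable {A : Type*} [Ring A] [Algebra k A]

open Algebra.TensorProduct in
/-- `∑ S(h₁)₁ ⊗ h₂ ⊗ ε(S(h₁)₂) h₃ = ∑ S(h₁) ⊗ h₂ ⊗ h₃`. -/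
lemma lTensor_coalgSnd_comul_antipodeTmul :
    (coalgSnd k H H).toLinearMap.lTensor (H ⊗[k] H) ∘ₗ comul ∘ₗ antipodeTmul k H =
      (antipodeTmul k H).rTensor H ∘ₗ comul := by
  let pr : H ⊗[k] H →ₐ[k] H := (Algebra.TensorProduct.lid k H).toAlgHom.comp
    (Algebra.TensorProduct.map (Bialgebra.counitAlgHom k H) (AlgHom.id k H))
  -- Being an algebra homomorphism, `Φ` acts on convolution words letter by letter, so it suffices
  -- to know it on the two inclusions of `H`.
  let Φ : H ⊗[k] H →ₐ[k] (H ⊗[k] H) ⊗[k] H :=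
    (Algebra.TensorProduct.map (AlgHom.id k _) pr).comp (Bialgebra.comulAlgHom k (H ⊗[k] H))
  have hL : toConv ((coalgSnd k H H).toLinearMap.lTensor (H ⊗[k] H) ∘ₗ comul ∘ₗ
      antipodeTmul k H) = convMap H Φ (toConv (antipodeTmul k H)) := by
    refine WithConv.ext (LinearMap.ext fun x => ?_)
    change _ = Algebra.TensorProduct.map (AlgHom.id k _) pr (comul (antipodeTmul k H x))
    change LinearMap.lTensor _ _ (comul (antipodeTmul k H x)) = _
    generalize comul (R := k) (antipodeTmul k H x) = z
    induction z with
    | zero => simp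
    | add x y hx hy => rw [map_add, map_add, hx, hy]
    | tmul a b =>
      simp only [LinearMap.lTensor_tmul, Algebra.TensorProduct.map_tmul]
      refine congrArg _ ?_
      induction b with
      | zero => simp
      | add x y hx hy => rw [map_add, map_add, hx, hy]
      | tmul a b => simp [pr]
  have h1 : convMap H Φ (convMap H includeLeft (convAntipode k H)) =
      convMap H (includeLeft.comp includeLeft) (convAntipode k H) := by
    have : Φ.comp includeLeft = includeLeft.comp includeLeft := by
      ext x
      simp only [Φ, pr, AlgHom.comp_apply, includeLeft_apply, Bialgebra.comulAlgHom_apply,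
        TensorProduct.comul_tmul, Bialgebra.comul_one]
      conv_rhs => rw [← sum_counit_right_smul (ℛ k x)]
      rw [← (ℛ k x).eq]
      simp [sum_tmul, Algebra.TensorProduct.one_def, smul_tmul']
    exact congrArg (fun φ => convMap H φ (convAntipode k H)) this
  have h2 : convMap H Φ (convMap H includeRight (convId k H)) =
      convMap H (includeLeft.comp includeRight) (convId k H) *
        convMap H includeRight (convId k H) := by
    refine WithConv.ext (LinearMap.ext fun x => ?_)
    refine Eq.trans ?_ ((ℛ k x).convMul_apply _ _).symm
    change Φ (1 ⊗ₜ x) = _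
    simp only [Φ, pr, AlgHom.comp_apply, Bialgebra.comulAlgHom_apply,
        TensorProduct.comul_tmul, Bialgebra.comul_one]
    rw [← (ℛ k x).eq]
    simp [tmul_sum, Algebra.TensorProduct.one_def, convMap]
  apply WithConv.toConv_injective
  rw [hL, toConv_antipodeTmul, map_mul, h1, h2]
  refine Eq.trans ?_ (map_comp_comul (antipodeTmul k H) LinearMap.id).symm
  rw [toConv_antipodeTmul, map_mul, mul_assoc]
  rfl

/-- `∑ X(S(h₁)₁, (h₂)₁) ε(S(h₁)₂) g((h₂)₂) = ∑ X(S(h₁), h₂) g(h₃)`. -/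
lemma conv_mul_snd_comp_antipodeTmul (X : WithConv (H ⊗[k] H →ₗ[k] A)) (g : WithConv (H →ₗ[k] A)) :
    toConv ((X * convComap A (coalgSnd k H H) g).ofConv ∘ₗ antipodeTmul k H) =
      toConv (X.ofConv ∘ₗ antipodeTmul k H) * g := by
  refine WithConv.ext (LinearMap.ext fun x => ?_)
  have h := congrArg (fun f => (LinearMap.mul' k A ∘ₗ TensorProduct.map X.ofConv g.ofConv) ∘ₗ f)
    (lTensor_coalgSnd_comul_antipodeTmul (k := k) (H := H))
  simp only [LinearMap.comp_assoc, ← LinearMap.comp_assoc _ (LinearMap.lTensor _ _),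
    ← LinearMap.comp_assoc _ (LinearMap.rTensor _ _), LinearMap.map_comp_lTensor,
    LinearMap.map_comp_rTensor] at h
  exact LinearMap.congr_fun h x

lemma conv_fst_mul_snd_comp_tmulAntipodeTmul (f : WithConv (H →ₗ[k] A))
    (Y : WithConv (H ⊗[k] H →ₗ[k] A)) :
    toConv ((convComap A (coalgFst k H (H ⊗[k] H)) f *
      convComap A (coalgSnd k H (H ⊗[k] H)) Y).ofConv ∘ₗ tmulAntipodeTmul k H) =
      f * toConv (Y.ofConv ∘ₗ antipodeTmul k H) := by
  rw [conv_fst_snd]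
  refine WithConv.ext (LinearMap.ext fun x => ?_)
  refine Eq.trans ?_ ((ℛ k x).convMul_apply _ _).symm
  simp [tmulAntipodeTmul, ← (ℛ k x).eq]

section Inclusions

variable {D : Type*} [Ring D] [Algebra k D] (Δ : D →ₐ[k] D ⊗[k] D)

open Algebra.TensorProduct

variable (H) in
/-- The comultiplication of `H ⊗ D` as an algebra homomorphism. -/
def tensorComulAlgHom : H ⊗[k] D →ₐ[k] (H ⊗[k] D) ⊗[k] (H ⊗[k] D) :=
  (Algebra.TensorProduct.tensorTensorTensorComm k k k k H H D D).toAlgHom.comp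
    (Algebra.TensorProduct.map (Bialgebra.comulAlgHom k H) Δ)

lemma tensorComulAlgHom_tmul_one (x : H) : tensorComulAlgHom H Δ (x ⊗ₜ[k] (1 : D)) =
    TensorProduct.map (includeLeft : H →ₐ[k] H ⊗[k] D).toLinearMap
      (includeLeft : H →ₐ[k] H ⊗[k] D).toLinearMap (comul x) := by
  change Algebra.TensorProduct.tensorTensorTensorComm k k k k H H D D
    (comul (R := k) x ⊗ₜ Δ 1) = _
  rw [map_one, ← (ℛ k x).eq]
  simp [sum_tmul, Algebra.TensorProduct.one_def]

lemma tensorComulAlgHom_one_tmul (d : D) : tensorComulAlgHom H Δ ((1 : H) ⊗ₜ[k] d) =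
    TensorProduct.map (includeRight : D →ₐ[k] H ⊗[k] D).toLinearMap
      (includeRight : D →ₐ[k] H ⊗[k] D).toLinearMap (Δ d) := by
  change Algebra.TensorProduct.tensorTensorTensorComm k k k k H H D D
    (comul (R := k) (1 : H) ⊗ₜ Δ d) = _
  rw [Bialgebra.comul_one]
  generalize Δ d = z
  induction z with
  | zero => simp
  | add x y hx hy => rw [tmul_add, map_add, map_add, hx, hy]
  | tmul x y => simp [Algebra.TensorProduct.one_def]

lemma convMap_comp_of_comul {j : H →ₐ[k] D} (hj : ∀ x, Δ (j x) =
    TensorProduct.map j.toLinearMap j.toLinearMap (comul x)) :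
    convMap H (Δ.comp j) (convId k H) =
      convMap H ((includeLeft : D →ₐ[k] D ⊗[k] D).comp j) (convId k H) *
        convMap H ((includeRight : D →ₐ[k] D ⊗[k] D).comp j) (convId k H) := by
  refine Eq.trans ?_ (map_comp_comul j.toLinearMap j.toLinearMap)
  exact WithConv.ext (LinearMap.ext hj)

/-- The word which computes the comultiplication of `∑ h₁ ⊗ a(S(h₂)) b(h₃)`. -/
lemma comul_tmul_antipode_mul (a b : H →ₐ[k] D)
    (ha : ∀ x, Δ (a x) = TensorProduct.map a.toLinearMap a.toLinearMap (comul x))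
    (hb : ∀ x, Δ (b x) = TensorProduct.map b.toLinearMap b.toLinearMap (comul x)) :
    convMap H (tensorComulAlgHom H Δ) (toConv ((convMap H a (convAntipode k H) *
      convMap H b (convId k H)).ofConv.lTensor H ∘ₗ comul)) =
      convMap H ((includeLeft : H ⊗[k] D →ₐ[k] (H ⊗[k] D) ⊗[k] (H ⊗[k] D)).comp includeLeft)
          (convId k H) *
      (convMap H ((includeRight : H ⊗[k] D →ₐ[k] (H ⊗[k] D) ⊗[k] (H ⊗[k] D)).comp includeLeft)
          (convId k H) *
      (convMap H ((includeRight : H ⊗[k] D →ₐ[k] (H ⊗[k] D) ⊗[k] (H ⊗[k] D)).comp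
          (includeRight.comp a)) (convAntipode k H) *
      (convMap H ((includeLeft : H ⊗[k] D →ₐ[k] (H ⊗[k] D) ⊗[k] (H ⊗[k] D)).comp
          (includeRight.comp a)) (convAntipode k H) *
      (convMap H ((includeLeft : H ⊗[k] D →ₐ[k] (H ⊗[k] D) ⊗[k] (H ⊗[k] D)).comp
          (includeRight.comp b)) (convId k H) *
      convMap H ((includeRight : H ⊗[k] D →ₐ[k] (H ⊗[k] D) ⊗[k] (H ⊗[k] D)).comp
          (includeRight.comp b)) (convId k H))))) := by
  have hr : ∀ f : H →ₐ[k] D,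
      (∀ x, Δ (f x) = TensorProduct.map f.toLinearMap f.toLinearMap (comul x)) →
      ∀ x, tensorComulAlgHom H Δ ((includeRight : D →ₐ[k] H ⊗[k] D).comp f x) =
        TensorProduct.map ((includeRight : D →ₐ[k] H ⊗[k] D).comp f).toLinearMap
          ((includeRight : D →ₐ[k] H ⊗[k] D).comp f).toLinearMap (comul x) := by
    intro f hf x
    refine (tensorComulAlgHom_one_tmul Δ (f x)).trans ?_
    rw [hf, ← LinearMap.comp_apply, ← TensorProduct.map_comp]
    rfl
  have h₁ := convMap_comp_of_comul (tensorComulAlgHom H Δ) (j := includeLeft)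
    (tensorComulAlgHom_tmul_one Δ)
  have h₂ := convMap_antipode_of_mul (convMap_comp_of_comul (tensorComulAlgHom H Δ) (hr a ha))
  have h₃ := convMap_comp_of_comul (tensorComulAlgHom H Δ) (hr b hb)
  have hw : toConv ((convMap H a (convAntipode k H) *
      convMap H b (convId k H)).ofConv.lTensor H ∘ₗ comul) =
      convMap H (includeLeft : H →ₐ[k] H ⊗[k] D) (convId k H) *
      (convMap H (includeRight.comp a) (convAntipode k H) *
        convMap H (includeRight.comp b) (convId k H)) := by
    refine (map_comp_comul _ _).trans ?_
    rw [WithConv.toConv_ofConv, map_mul]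
    rfl
  rw [hw, map_mul, map_mul]
  refine (congrArg₂ (· * ·) h₁ (congrArg₂ (· * ·) h₂ h₃)).trans ?_
  simp only [mul_assoc]

end Inclusions

open Algebra.TensorProduct in
/-- `∑ h₁ ⊗ S(h₄) h₅ ⊗ h₂ S(h₃) ⊗ h₆ = ∑ h₁ ⊗ 1 ⊗ 1 ⊗ h₂`. -/
lemma map_mul_comul_tmulAntipodeTmul :
    TensorProduct.map ((LinearMap.mul' k H).lTensor H) ((LinearMap.mul' k H).rTensor H ∘ₗ
        (TensorProduct.assoc k H H H).symm.toLinearMap) ∘ₗ comul ∘ₗ tmulAntipodeTmul k H =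
      TensorProduct.map (includeLeft : H →ₐ[k] H ⊗[k] H).toLinearMap
        (includeRight : H →ₐ[k] H ⊗[k] H).toLinearMap ∘ₗ comul := by
  have hw := comul_tmul_antipode_mul (H := H)
    (tensorComulAlgHom H (Bialgebra.comulAlgHom k H)) includeLeft includeRight
    (tensorComulAlgHom_tmul_one _) (tensorComulAlgHom_one_tmul _)
  rw [← toConv_antipodeTmul] at hw
  let l₁ : H →ₐ[k] (H ⊗[k] H) ⊗[k] (H ⊗[k] H) := includeLeft.comp includeLeft
  let l₂ : H →ₐ[k] (H ⊗[k] H) ⊗[k] (H ⊗[k] H) := includeLeft.comp includeRight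
  let l₃ : H →ₐ[k] (H ⊗[k] H) ⊗[k] (H ⊗[k] H) := includeRight.comp includeLeft
  let l₄ : H →ₐ[k] (H ⊗[k] H) ⊗[k] (H ⊗[k] H) := includeRight.comp includeRight
  have hm : toConv (TensorProduct.map ((LinearMap.mul' k H).lTensor H)
      ((LinearMap.mul' k H).rTensor H ∘ₗ (TensorProduct.assoc k H H H).symm.toLinearMap) ∘ₗ
        comul ∘ₗ tmulAntipodeTmul k H) =
      convMap H l₁ (convId k H) * (convMap H l₃ (convId k H) * (convMap H l₃ (convAntipode k H) *
        (convMap H l₂ (convAntipode k H) * (convMap H l₂ (convId k H) *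
          convMap H l₄ (convId k H))))) := by
    refine WithConv.ext (LinearMap.ext fun x => ?_)
    have hw' := congrArg (fun f => f.ofConv x) hw
    refine (congrArg (TensorProduct.map ((LinearMap.mul' k H).lTensor H)
      ((LinearMap.mul' k H).rTensor H ∘ₗ (TensorProduct.assoc k H H H).symm.toLinearMap))
      hw').trans ?_
    -- Six letters give five nested convolution sums; the multiplications only merge tensor legs, so
    -- the sums agree term by term.
    simp only [fun (B : Type _) [Ring B] [Algebra k B] (f g : WithConv (H →ₗ[k] B)) x =>
      (ℛ k x).convMul_apply f g, Finset.mul_sum, map_sum]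
    iterate 5 refine Finset.sum_congr rfl fun _ _ => ?_
    simp [convMap, l₁, l₂, l₃, l₄, Algebra.TensorProduct.one_def]
  apply WithConv.toConv_injective
  -- The adjacent mutually inverse letters of `l₃`, then those of `l₂`, cancel, leaving the word `l₁
  -- l₄`.
  rw [hm, map_comp_comul, ← mul_assoc (convMap H l₃ _), convMap_id_mul_antipode, one_mul,
    ← mul_assoc (convMap H l₂ _), convMap_antipode_mul_id, one_mul]
  rfl

/-- `∑ X(h₁, S(h₄) h₅) Y(h₂ S(h₃), h₆) = ∑ X(h₁, 1) Y(1, h₂)`. -/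
lemma conv_mul_comp_tmulAntipodeTmul (X Y : WithConv (H ⊗[k] H →ₗ[k] A)) :
    toConv ((toConv (X.ofConv ∘ₗ (LinearMap.mul' k H).lTensor H) *
      toConv (Y.ofConv ∘ₗ (LinearMap.mul' k H).rTensor H ∘ₗ
        (TensorProduct.assoc k H H H).symm.toLinearMap)).ofConv ∘ₗ tmulAntipodeTmul k H) =
      toConv (X.ofConv ∘ₗ (Algebra.TensorProduct.includeLeft : H →ₐ[k] H ⊗[k] H).toLinearMap) *
      toConv (Y.ofConv ∘ₗ
        (Algebra.TensorProduct.includeRight : H →ₐ[k] H ⊗[k] H).toLinearMap) := by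
  refine WithConv.ext (LinearMap.ext fun x => ?_)
  have h := LinearMap.congr_fun (congrArg
    (fun f => (LinearMap.mul' k A ∘ₗ TensorProduct.map X.ofConv Y.ofConv) ∘ₗ f)
    (map_mul_comul_tmulAntipodeTmul (k := k) (H := H))) x
  simp only [LinearMap.comp_apply, ← LinearMap.comp_apply (TensorProduct.map X.ofConv Y.ofConv),
    ← TensorProduct.map_comp] at h
  exact h

end Hopf

end Convolution

/-! ### Convolution invertibility of `h ↦ 1 # h` -/

namespace CrossedProduct

section Bialgebra

variable {k H R : Type*} [Field k] [Ring H] [Bialgebra k H] [Ring R] [Algebra k R]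
  {W : WeakAction k H R} (c : CrossedSystem W)

instance : Module k (CrossedProduct c) := inferInstanceAs (Module k (R ⊗[k] H))

instance : Algebra k (CrossedProduct c) :=
  Algebra.ofModule (fun r x y => c.mulMap.map_smul₂ r x y) (fun r x y => (c.mulMap x).map_smul r y)

/-- The identification of the vector space `R ⊗ H` with the crossed product. -/
def mk : R ⊗[k] H ≃ₗ[k] CrossedProduct c := LinearEquiv.refl k (R ⊗[k] H)

/-- The embedding `a ↦ a # 1` of `R` into the crossed product. -/
def incl : R →ₐ[k] CrossedProduct c :=
  AlgHom.ofLinearMap (mk c ∘ₗ (TensorProduct.mk k R H).flip 1) rfl fun a b => by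
    change (a * b) ⊗ₜ[k] (1 : H) = c.mulMap (a ⊗ₜ[k] (1 : H)) (b ⊗ₜ[k] (1 : H))
    rw [c.mulMap_tmul_apply]
    have := c.mulMap_one_left (b ⊗ₜ[k] (1 : H))
    rw [c.mulMap_tmul_apply, one_smul] at this
    rw [this, smul_tmul', smul_eq_mul]

/-- The map `h ↦ 1 # h` of `H` into the crossed product. -/
def gen : WithConv (H →ₗ[k] CrossedProduct c) :=
  toConv (mk c ∘ₗ TensorProduct.mk k R H 1)

lemma incl_mul (a : R) (x : R ⊗[k] H) : incl c a * mk c x = mk c (a • x) := by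
  change c.mulMap (a ⊗ₜ[k] (1 : H)) x = a • x
  rw [c.mulMap_tmul_apply]
  have := c.mulMap_one_left x
  rw [c.mulMap_tmul_apply, one_smul] at this
  rw [this]

lemma mk_tmul (a : R) (h : H) : mk c (a ⊗ₜ h) = incl c a * gen c h := by
  refine Eq.trans ?_ (incl_mul c a (1 ⊗ₜ h)).symm
  rw [smul_tmul', smul_eq_mul, mul_one]

lemma gen_one : gen c 1 = 1 := rfl

lemma gen_mul_incl (h : H) (b : R) : gen c h * incl c b =
    (convMap H (incl c) (toConv (W.act.flip b)) * gen c) h := by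
  rw [(ℛ k h).convMul_apply]
  change c.mulMap (1 ⊗ₜ[k] h) (b ⊗ₜ[k] (1 : H)) = ∑ i ∈ (ℛ k h).index,
    incl c (W.act ((ℛ k h).left i) b) * mk c (1 ⊗ₜ (ℛ k h).right i)
  rw [c.mulMap_tmul, one_smul, CrossedSystem.actPart_mul_tmul]
  refine Finset.sum_congr rfl fun i _ => ?_
  rw [incl_mul, c.cocyclePart_tmul_one]
  rfl

lemma gen_mul_gen : convComap _ (coalgFst k H H) (gen c) * convComap _ (coalgSnd k H H) (gen c) =
    convMap (H ⊗[k] H) (incl c) c.σ.val * toConv ((gen c).ofConv ∘ₗ LinearMap.mul' k H) := by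
  rw [conv_fst_snd]
  refine WithConv.ext (TensorProduct.ext' fun h g => ?_)
  refine Eq.trans ?_ ((ℛ k (h ⊗ₜ[k] g)).convMul_apply _ _).symm
  change c.mulMap (1 ⊗ₜ[k] h) (1 ⊗ₜ[k] g) = ∑ i ∈ (ℛ k (h ⊗ₜ[k] g)).index,
    incl c (c.σ.val ((ℛ k (h ⊗ₜ[k] g)).left i)) *
      mk c (1 ⊗ₜ LinearMap.mul' k H ((ℛ k (h ⊗ₜ[k] g)).right i))
  have h1 : CrossedSystem.actPart W 1 = 1 := by
    refine WithConv.ext (TensorProduct.ext' fun x y => ?_)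
    simp [CrossedSystem.actPart, W.act_one, LinearMap.convOne_def, Algebra.algebraMap_eq_smul_one,
      smul_smul, mul_comm, Algebra.TensorProduct.one_def, smul_tmul']
  rw [c.mulMap_tmul, one_smul, h1, one_mul, CrossedSystem.cocyclePart,
    (ℛ k (h ⊗ₜ[k] g)).convMul_apply]
  refine Finset.sum_congr rfl fun i _ => ?_
  rw [incl_mul]
  exact CrossedSystem.includeLeft_mul _ _

/-- The commutation rule `γ(h) b = ∑ (h₁ · b) γ(h₂)` with a coefficient `b = f(x)` that varies, as
needed to move `γ` past `σ⁻¹(g, m)`. -/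
lemma gen_fst_mul_incl_snd {C : Type*} [AddCommGroup C] [Module k C] [Coalgebra k C]
    (f : WithConv (C →ₗ[k] R)) :
    convComap _ (coalgFst k H C) (gen c) *
        convComap _ (coalgSnd k H C) (convMap C (incl c) f) =
      convMap (H ⊗[k] C) (incl c) (toConv (W.actOn f.ofConv)) *
        convComap _ (coalgFst k H C) (gen c) := by
  rw [conv_fst_snd]
  refine WithConv.ext (TensorProduct.ext' fun h x => ?_)
  refine Eq.trans ?_ (CrossedSystem.conv_tmul _ _ h x).symm
  change gen c h * incl c (f x) = ∑ i ∈ (ℛ k h).index, ∑ j ∈ (ℛ k x).index,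
    incl c (W.act ((ℛ k h).left i) (f ((ℛ k x).left j))) *
      gen c (counit (R := k) ((ℛ k x).right j) • (ℛ k h).right i)
  rw [gen_mul_incl, (ℛ k h).convMul_apply]
  refine Finset.sum_congr rfl fun i _ => ?_
  change incl c (W.act ((ℛ k h).left i) (f.ofConv x)) * gen c ((ℛ k h).right i) = _
  conv_lhs => rw [← sum_counit_right_smul (ℛ k x)]
  rw [map_sum, map_sum, map_sum, Finset.sum_mul]
  refine Finset.sum_congr rfl fun j _ => ?_
  simp only [map_smul, smul_mul_assoc, mul_smul_comm]

end Bialgebra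

section Hopf

variable {k H R : Type*} [Field k] [Ring H] [HopfAlgebra k H] [Ring R] [Algebra k R]
  {W : WeakAction k H R} (c : CrossedSystem W)

/-- The convolution inverse of `h ↦ 1 # h`, namely `h ↦ ∑ σ⁻¹(S(h₂), h₃) # S(h₁)`. -/
def genInv : WithConv (H →ₗ[k] CrossedProduct c) :=
  toConv ((convMap (H ⊗[k] H) (incl c) c.σ.inv *
    convComap _ (coalgFst k H H) (gen c)).ofConv ∘ₗ antipodeTmul k H)

/-- Since `γ(g) γ(m) = ∑ σ(g₁, m₁) γ(g₂ m₂)`, the factor `σ⁻¹` cancels and `γ(∑ S(h₁) h₂) = ε(h)`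
remains. -/
lemma genInv_mul_gen : genInv c * gen c = 1 := by
  rw [genInv, ← conv_mul_snd_comp_antipodeTmul, mul_assoc, gen_mul_gen, ← mul_assoc, ← map_mul,
    c.σ.inv_val, map_one, one_mul]
  have h : toConv (LinearMap.mul' k H ∘ₗ antipodeTmul k H) = 1 := by
    refine Eq.trans ?_ LinearMap.antipode_mul_id
    rfl
  refine WithConv.ext (LinearMap.ext fun x => ?_)
  change gen c ((toConv (LinearMap.mul' k H ∘ₗ antipodeTmul k H)) x) = _
  rw [h]
  simp [Algebra.algebraMap_eq_smul_one, gen_one]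

/-- The inverse of `h ⊗ g ⊗ m ↦ h · σ(g, m)`. -/
lemma actOn_inv_mul : toConv (W.actOn c.σ.inv.ofConv) * toConv (W.actOn c.σ.val.ofConv) = 1 := by
  rw [← CrossedSystem.actOn_conv, c.σ.inv_val]
  refine WithConv.ext (TensorProduct.ext' fun h x => ?_)
  simp [LinearMap.convOne_def, Algebra.algebraMap_eq_smul_one, W.act_one, smul_smul, mul_comm]

/-- The coalgebra homomorphism `h ⊗ g ⊗ m ↦ h g ⊗ m`. -/
def mulLeftCoalgHom (k H : Type*) [Field k] [Ring H] [Bialgebra k H] :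
    H ⊗[k] (H ⊗[k] H) →ₗc[k] H ⊗[k] H :=
  (CoalgHom.rTensor H (CrossedSystem.mulCoalgHom k H)).comp (CrossedSystem.assocInv k H)

lemma toLinearMap_mulLeftCoalgHom (k H : Type*) [Field k] [Ring H] [Bialgebra k H] :
    (mulLeftCoalgHom k H).toLinearMap = (LinearMap.mul' k H).rTensor H ∘ₗ
      (TensorProduct.assoc k H H H).symm.toLinearMap :=
  TensorProduct.ext_threefold' fun _ _ _ => rfl

/-- The coalgebra homomorphism `h ⊗ g ⊗ m ↦ ε(m) h ⊗ g`. -/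
def fstSnd (k H : Type*) [Field k] [Ring H] [Bialgebra k H] :
    H ⊗[k] (H ⊗[k] H) →ₗc[k] H ⊗[k] H :=
  (coalgFst k (H ⊗[k] H) H).comp (CrossedSystem.assocInv k H)

@[simp] lemma mulLeftCoalgHom_tmul {k H : Type*} [Field k] [Ring H] [Bialgebra k H] (x y z : H) :
    mulLeftCoalgHom k H (x ⊗ₜ (y ⊗ₜ z)) = (x * y) ⊗ₜ z := rfl

@[simp] lemma fstSnd_tmul {k H : Type*} [Field k] [Ring H] [Bialgebra k H] (x y z : H) :
    fstSnd k H (x ⊗ₜ (y ⊗ₜ z)) = counit (R := k) z • (x ⊗ₜ[k] y) := rfl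

lemma inv_one_tmul (x : H) : c.σ.inv (1 ⊗ₜ x) = algebraMap k R (counit x) := by
  have h := congrArg (fun f : WithConv (H ⊗[k] H →ₗ[k] R) => f (1 ⊗ₜ x)) c.σ.inv_val
  simp only [CrossedSystem.conv_one_tmul, c.apply_one_left] at h
  refine Eq.trans ?_ (h.trans (by simp [LinearMap.convOne_def]))
  conv_lhs => rw [← sum_counit_right_smul (ℛ k x)]
  rw [tmul_sum, map_sum]
  refine Finset.sum_congr rfl fun i _ => ?_
  rw [tmul_smul, map_smul, Algebra.algebraMap_eq_smul_one, mul_smul_comm, mul_one]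

/-- The cocycle identity with `h · σ(g, m)` and `σ(h g, m)` each moved to the opposite side. -/
lemma actOn_inv_mul_fstSnd :
    toConv (W.actOn c.σ.inv.ofConv) * convComap R (fstSnd k H) c.σ.val =
      toConv (c.σ.val.ofConv ∘ₗ (LinearMap.mul' k H).lTensor H) *
        convComap R (mulLeftCoalgHom k H) c.σ.inv := by
  have h : toConv (W.actOn c.σ.val.ofConv) *
      toConv (c.σ.val.ofConv ∘ₗ (LinearMap.mul' k H).lTensor H) =
      convComap R (fstSnd k H) c.σ.val * convComap R (mulLeftCoalgHom k H) c.σ.val := by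
    refine c.cocycle.trans (congrArg₂ (· * ·) ?_ rfl)
    refine WithConv.ext (TensorProduct.ext_threefold' fun x y z => ?_)
    exact (map_smul c.σ.val.ofConv _ _).symm
  have h2 := congrArg (fun z => toConv (W.actOn c.σ.inv.ofConv) * z *
    convComap R (mulLeftCoalgHom k H) c.σ.inv) h
  simp only [mul_assoc] at h2
  rw [← map_mul, c.σ.val_inv, map_one, mul_one, ← mul_assoc, actOn_inv_mul, one_mul] at h2
  exact h2.symm

lemma incl_cocycle_tmul_one : toConv ((convMap (H ⊗[k] H) (incl c) c.σ.val).ofConv ∘ₗ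
    (Algebra.TensorProduct.includeLeft : H →ₐ[k] H ⊗[k] H).toLinearMap) = 1 := by
  refine WithConv.ext (LinearMap.ext fun x => ?_)
  change incl c (c.σ.val (x ⊗ₜ 1)) = algebraMap k (CrossedProduct c) (counit x)
  rw [c.apply_one_right, AlgHom.commutes]

lemma incl_inv_mul_gen_one_tmul : toConv ((convMap (H ⊗[k] H) (incl c) c.σ.inv *
    convComap (CrossedProduct c) (coalgFst k H H) (gen c)).ofConv ∘ₗ
      (Algebra.TensorProduct.includeRight : H →ₐ[k] H ⊗[k] H).toLinearMap) = 1 := by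
  refine WithConv.ext (LinearMap.ext fun x => ?_)
  refine (CrossedSystem.conv_one_tmul (convMap (H ⊗[k] H) (incl c) c.σ.inv)
    (convComap (CrossedProduct c) (coalgFst k H H) (gen c)) x).trans ?_
  change ∑ j ∈ (ℛ k x).index, incl c (c.σ.inv (1 ⊗ₜ (ℛ k x).left j)) *
    gen c (counit (R := k) ((ℛ k x).right j) • 1) =
      algebraMap k (CrossedProduct c) (counit x)
  conv_rhs => rw [← sum_counit_right_smul (ℛ k x), map_sum, map_sum]
  refine Finset.sum_congr rfl fun j _ => ?_
  rw [inv_one_tmul, AlgHom.commutes, map_smul, map_smul, gen_one, mul_smul_comm, mul_one, smul_eq_mul,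
    map_mul, Algebra.smul_def]

/-- The product is the pullback along `h ↦ ∑ h₁ ⊗ S(h₂) ⊗ h₃` of the convolution product of `γ(h)`,
`σ⁻¹(g, m)` and `γ(g)`. Moving `γ(h)` to the right and merging it with `γ(g)` gives `(h · σ⁻¹(g, m))
σ(h, g) γ(h g)`, which the cocycle identity turns into `σ(h, g m) σ⁻¹(h g, m) γ(h g)`. Under the
pullback the antipode reduces `g m` and `h g` to `1`, and normalization finishes. -/
lemma gen_mul_genInv : gen c * genInv c = 1 := by
  set A := CrossedProduct c
  let i₃ := convMap (H ⊗[k] (H ⊗[k] H)) (incl c)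
  have h12 : convComap A (coalgFst k H (H ⊗[k] H)) (gen c) *
      convComap A (coalgSnd k H (H ⊗[k] H)) (convComap A (coalgFst k H H) (gen c)) =
      i₃ (convComap R (fstSnd k H) c.σ.val) *
        convComap A (mulLeftCoalgHom k H) (convComap A (coalgFst k H H) (gen c)) := by
    have h := congrArg (convComap A (fstSnd k H)) (gen_mul_gen c)
    rw [map_mul, map_mul] at h
    refine Eq.trans (congrArg₂ (· * ·) ?_ ?_) (h.trans (congrArg₂ (· * ·) rfl ?_))
    · refine WithConv.ext (TensorProduct.ext_threefold' fun x y z => congrArg (gen c) ?_)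
      change coalgFst k H (H ⊗[k] H) (x ⊗ₜ (y ⊗ₜ z)) = coalgFst k H H (fstSnd k H (x ⊗ₜ (y ⊗ₜ z)))
      simp [smul_smul, mul_comm]
    · refine WithConv.ext (TensorProduct.ext_threefold' fun x y z => congrArg (gen c) ?_)
      change coalgFst k H H (coalgSnd k H (H ⊗[k] H) (x ⊗ₜ (y ⊗ₜ z))) =
        coalgSnd k H H (fstSnd k H (x ⊗ₜ (y ⊗ₜ z)))
      simp [smul_smul, mul_comm]
    · refine WithConv.ext (TensorProduct.ext_threefold' fun x y z => congrArg (gen c) ?_)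
      change LinearMap.mul' k H (fstSnd k H (x ⊗ₜ (y ⊗ₜ z))) =
        coalgFst k H H (mulLeftCoalgHom k H (x ⊗ₜ (y ⊗ₜ z)))
      simp
  rw [genInv, ← conv_fst_mul_snd_comp_tmulAntipodeTmul, map_mul, ← mul_assoc,
    gen_fst_mul_incl_snd, mul_assoc, h12, ← mul_assoc, ← map_mul, actOn_inv_mul_fstSnd, map_mul,
    mul_assoc]
  have hY := conv_mul_comp_tmulAntipodeTmul (convMap (H ⊗[k] H) (incl c) c.σ.val)
    (convMap (H ⊗[k] H) (incl c) c.σ.inv * convComap A (coalgFst k H H) (gen c))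
  refine Eq.trans ?_ (hY.trans ?_)
  · refine congrArg (fun z : WithConv (H ⊗[k] (H ⊗[k] H) →ₗ[k] A) =>
      toConv (z.ofConv ∘ₗ tmulAntipodeTmul k H))
      (congrArg₂ (· * ·) rfl ?_)
    rw [← toLinearMap_mulLeftCoalgHom]
    refine Eq.trans ?_ (map_mul (convComap A (mulLeftCoalgHom k H)) _ _).symm
    rfl
  · rw [incl_cocycle_tmul_one, incl_inv_mul_gen_one_tmul, one_mul]

end Hopf

end CrossedProduct

/-! ### Integrals and the Casimir element -/

/-- A semisimple bialgebra has a right integral `t` with `ε(t) = 1`. -/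
lemma exists_right_integral (k H : Type*) [Field k] [Ring H] [Bialgebra k H]
    [IsSemisimpleRing H] :
    ∃ t : H, counit (R := k) t = 1 ∧ ∀ h, t * h = counit (R := k) h • t := by
  -- Left ideals of the opposite ring are right ideals of `H`. The integral is the component of `1`
  -- in a complement of the kernel of the counit.
  let e : Hᵐᵒᵖ →+* kᵐᵒᵖ := (Bialgebra.counitAlgHom k H).toRingHom.op
  have he : ∀ x : H, e (MulOpposite.op x) = MulOpposite.op (counit (R := k) x) := fun _ => rfl
  obtain ⟨J, hJ⟩ := exists_isCompl (RingHom.ker e)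
  obtain ⟨a, ha, s, hs, h1⟩ := Submodule.mem_sup.1
    (hJ.sup_eq_top ▸ Submodule.mem_top : (1 : Hᵐᵒᵖ) ∈ RingHom.ker e ⊔ J)
  have hes : e s = 1 := by
    rw [← map_one e, ← h1, map_add, (RingHom.mem_ker).1 ha, zero_add]
  refine ⟨s.unop, MulOpposite.op_injective hes, fun h => ?_⟩
  have hmem : MulOpposite.op h * s - MulOpposite.op (algebraMap k H (counit h)) * s ∈ J :=
    sub_mem (J.smul_mem _ hs) (J.smul_mem _ hs)
  have hker : MulOpposite.op h * s - MulOpposite.op (algebraMap k H (counit h)) * s ∈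
      RingHom.ker e := by
    rw [RingHom.mem_ker, map_sub, map_mul, map_mul, he, he, Bialgebra.counit_algebraMap, sub_self]
  have h0 := sub_eq_zero.1 (Submodule.disjoint_def.1 hJ.disjoint _ hker hmem)
  have := congrArg MulOpposite.unop h0
  simp only [MulOpposite.unop_mul, MulOpposite.unop_op] at this
  rw [this, ← Algebra.commutes, Algebra.smul_def]

section Balanced

variable {k : Type*} [Field k]

/-- The constant `a` as an element of a convolution algebra. -/
def convConst {A : Type*} (C : Type*) [Ring A] [Algebra k A] [AddCommGroup C] [Module k C]
    [Coalgebra k C] (a : A) : WithConv (C →ₗ[k] A) :=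
  toConv (LinearMap.toSpanSingleton k A a ∘ₗ counit)

variable {A C : Type*} [Ring A] [Algebra k A] [AddCommGroup C] [Module k C] [Coalgebra k C]

lemma conv_mul_const (f : WithConv (C →ₗ[k] A)) (a : A) (x : C) :
    (f * convConst C a : WithConv (C →ₗ[k] A)) x = f x * a := by
  rw [(ℛ k x).convMul_apply]
  conv_rhs => rw [← sum_counit_right_smul (ℛ k x), map_sum, Finset.sum_mul]
  refine Finset.sum_congr rfl fun i _ => ?_
  simp [convConst]

lemma convConst_mul (f : WithConv (C →ₗ[k] A)) (a : A) (x : C) :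
    (convConst C a * f : WithConv (C →ₗ[k] A)) x = a * f x := by
  rw [(ℛ k x).convMul_apply]
  conv_rhs => rw [← sum_counit_smul (ℛ k x), map_sum, Finset.mul_sum]
  refine Finset.sum_congr rfl fun i _ => ?_
  simp [convConst]

/-- A linear map on `A ⊗ A` which is balanced over the subring `ι(R)`. -/
def IsBalanced {R V : Type*} [Ring R] [Algebra k R] [AddCommGroup V] [Module k V]
    (ι : R →ₐ[k] A) (B : A ⊗[k] A →ₗ[k] V) : Prop :=
  ∀ r x y, B ((x * ι r) ⊗ₜ y) = B (x ⊗ₜ (ι r * y))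

lemma convMap_convConst {E : Type*} [Ring E] [Algebra k E] (φ : A →ₐ[k] E) (a : A) :
    convMap C φ (convConst C a) = convConst C (φ a) := by
  refine WithConv.ext (LinearMap.ext fun x => ?_)
  simp [convMap, convConst]

lemma convMap_convComap {D E : Type*} [AddCommGroup D] [Module k D] [Coalgebra k D] [Ring E]
    [Algebra k E] (φ : A →ₐ[k] E) (p : D →ₗc[k] C) (f : WithConv (C →ₗ[k] A)) :
    convMap D φ (convComap A p f) = convComap E p (convMap C φ f) := rfl

variable {R V : Type*} [Ring R] [Algebra k R] [AddCommGroup V] [Module k V] {ι : R →ₐ[k] A}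
  {B : A ⊗[k] A →ₗ[k] V}

-- Values of `ι` slide across the tensor sign inside a convolution word, even though they depend on
-- the argument.
open Algebra.TensorProduct in
lemma IsBalanced.conv_eq (hB : IsBalanced ι B) (f h : WithConv (C →ₗ[k] A))
    (g : WithConv (C →ₗ[k] R)) (x : C) :
    B ((convMap C includeLeft f * (convMap C includeRight (convMap C ι g) *
      convMap C includeRight h) :
        WithConv (C →ₗ[k] A ⊗[k] A)) x) =
    B ((convMap C includeLeft f * (convMap C includeLeft (convMap C ι g) *
      convMap C includeRight h) :
        WithConv (C →ₗ[k] A ⊗[k] A)) x) := by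
  simp only [fun (f g : WithConv (C →ₗ[k] A ⊗[k] A)) x => (ℛ k x).convMul_apply f g,
    Finset.mul_sum, map_sum]
  refine Finset.sum_congr rfl fun i _ => Finset.sum_congr rfl fun j _ => ?_
  simp [convMap, hB _ _ _]

end Balanced

namespace CrossedProduct

variable {k H R : Type*} [Field k] [Ring H] [HopfAlgebra k H] [Ring R] [Algebra k R]
  {W : WeakAction k H R} (c : CrossedSystem W)

open Algebra.TensorProduct

/-- The map `h ↦ ∑ γ⁻¹(h₁) ⊗ γ(h₂)`, where `γ(h) = 1 # h`. -/
def casimir : WithConv (H →ₗ[k] CrossedProduct c ⊗[k] CrossedProduct c) :=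
  convMap H includeLeft (genInv c) * convMap H includeRight (gen c)

lemma genInv_mul_incl (r : R) : genInv c * convMap H (incl c) (toConv (W.act.flip r)) =
    convConst H (incl c r) * genInv c := by
  have h : gen c * convConst H (incl c r) =
      convMap H (incl c) (toConv (W.act.flip r)) * gen c :=
    WithConv.ext (LinearMap.ext fun x => (conv_mul_const _ _ x).trans (gen_mul_incl c x r))
  have h2 := congrArg (fun z => genInv c * z * genInv c) h
  simp only [mul_assoc, gen_mul_genInv, mul_one] at h2
  rw [← h2, ← mul_assoc, genInv_mul_gen, one_mul]

/-- In Sweedler form, `∑ γ⁻¹(h₁) σ(h₂, g) = ∑ γ(g₁) γ⁻¹(h g₂)`: multiply the product rule for `γ` by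
inverses on both sides. -/
lemma genInv_fst_mul_cocycle :
    convComap _ (coalgFst k H H) (genInv c) * convMap (H ⊗[k] H) (incl c) c.σ.val =
      convComap _ (coalgSnd k H H) (gen c) *
        convComap _ (CrossedSystem.mulCoalgHom k H) (genInv c) := by
  have h : convComap _ (coalgFst k H H) (gen c) * convComap _ (coalgSnd k H H) (gen c) =
      convMap (H ⊗[k] H) (incl c) c.σ.val *
        convComap _ (CrossedSystem.mulCoalgHom k H) (gen c) := gen_mul_gen c
  have h2 := congrArg (fun z => convComap _ (coalgFst k H H) (genInv c) * z *
    convComap _ (CrossedSystem.mulCoalgHom k H) (genInv c)) h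
  simp only [mul_assoc] at h2
  rw [← map_mul (convComap _ (CrossedSystem.mulCoalgHom k H)), gen_mul_genInv, map_one, mul_one,
    ← mul_assoc, ← map_mul (convComap _ (coalgFst k H H)), genInv_mul_gen, map_one, one_mul] at h2
  exact h2.symm

lemma mul'_casimir (t : H) : LinearMap.mul' k (CrossedProduct c) (casimir c t) =
    algebraMap k _ (counit t) := by
  have h := congrArg (fun f => f.ofConv t) (genInv_mul_gen c)
  refine Eq.trans ?_ h
  change _ = (genInv c * gen c) t
  rw [casimir, (ℛ k t).convMul_apply, (ℛ k t).convMul_apply, map_sum]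
  refine Finset.sum_congr rfl fun i _ => ?_
  simp [convMap]

variable {V : Type*} [AddCommGroup V] [Module k V]
  {B : CrossedProduct c ⊗[k] CrossedProduct c →ₗ[k] V}

lemma casimir_incl (hB : IsBalanced (incl c) B) (t : H) (r : R) :
    B (casimir c t * (1 ⊗ₜ incl c r)) = B ((incl c r ⊗ₜ 1) * casimir c t) := by
  have hg : gen c * convConst H (incl c r) =
      convMap H (incl c) (toConv (W.act.flip r)) * gen c :=
    WithConv.ext (LinearMap.ext fun x => (conv_mul_const _ _ x).trans (gen_mul_incl c x r))
  have e1 : casimir c t * (1 ⊗ₜ incl c r) = (convMap H includeLeft (genInv c) *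
      (convMap H includeRight (convMap H (incl c) (toConv (W.act.flip r))) *
        convMap H includeRight (gen c)) :
          WithConv (H →ₗ[k] CrossedProduct c ⊗[k] CrossedProduct c)) t := by
    rw [← map_mul, ← hg, map_mul, convMap_convConst, ← mul_assoc]
    exact (conv_mul_const (casimir c) _ t).symm
  have e2 : (incl c r ⊗ₜ 1) * casimir c t = (convMap H includeLeft (genInv c) *
      (convMap H includeLeft (convMap H (incl c) (toConv (W.act.flip r))) *
        convMap H includeRight (gen c)) :
          WithConv (H →ₗ[k] CrossedProduct c ⊗[k] CrossedProduct c)) t := by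
    rw [← mul_assoc, ← map_mul, genInv_mul_incl, map_mul, convMap_convConst, mul_assoc]
    exact (convConst_mul (casimir c) _ t).symm
  rw [e1, e2, hB.conv_eq]

/-- Over `R`, `γ⁻¹(t₁) ⊗ γ(t₂) γ(h) = γ⁻¹(t₁) σ(t₂, h₁) ⊗ γ(t₃ h₂) = γ(h₁) γ⁻¹(t₁ h₂) ⊗ γ(t₂ h₃)`
with sums understood. This is `γ(h₁)` times the Casimir map at `t h₂ = ε(h₂) t`. -/
lemma casimir_gen (hB : IsBalanced (incl c) B) {t : H}
    (ht : ∀ h, t * h = counit (R := k) h • t) (h : H) :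
    B (casimir c t * (1 ⊗ₜ gen c h)) = B ((gen c h ⊗ₜ 1) * casimir c t) := by
  have e1 : casimir c t * (1 ⊗ₜ gen c h) =
      (convMap (H ⊗[k] H) includeLeft (convComap _ (coalgFst k H H) (genInv c)) *
        (convMap (H ⊗[k] H) includeRight (convMap (H ⊗[k] H) (incl c) c.σ.val) *
          convMap (H ⊗[k] H) includeRight
            (convComap _ (CrossedSystem.mulCoalgHom k H) (gen c))) :
        WithConv (H ⊗[k] H →ₗ[k] CrossedProduct c ⊗[k] CrossedProduct c)) (t ⊗ₜ h) := by
    have hg : convMap (H ⊗[k] H) (incl c) c.σ.val *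
        convComap _ (CrossedSystem.mulCoalgHom k H) (gen c) = _ := (gen_mul_gen c).symm
    rw [← map_mul, hg, map_mul, ← mul_assoc]
    rw [convMap_convComap, convMap_convComap, ← map_mul (convComap _ (coalgFst k H H)), ← casimir]
    exact (congrArg (fun f : WithConv (H ⊗[k] H →ₗ[k] _) => f (t ⊗ₜ h))
      (conv_fst_snd (casimir c) (convMap H includeRight (gen c)))).symm
  have e2 : (gen c h ⊗ₜ 1) * casimir c t =
      (convMap (H ⊗[k] H) includeLeft (convComap _ (coalgFst k H H) (genInv c)) *
        (convMap (H ⊗[k] H) includeLeft (convMap (H ⊗[k] H) (incl c) c.σ.val) *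
          convMap (H ⊗[k] H) includeRight
            (convComap _ (CrossedSystem.mulCoalgHom k H) (gen c))) :
        WithConv (H ⊗[k] H →ₗ[k] CrossedProduct c ⊗[k] CrossedProduct c)) (t ⊗ₜ h) := by
    rw [← mul_assoc, ← map_mul, genInv_fst_mul_cocycle, map_mul, mul_assoc]
    rw [convMap_convComap _ (CrossedSystem.mulCoalgHom k H),
      convMap_convComap _ (CrossedSystem.mulCoalgHom k H),
      ← map_mul (convComap _ (CrossedSystem.mulCoalgHom k H)), ← casimir]
    refine Eq.trans ?_ (CrossedSystem.conv_tmul _ _ t h).symm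
    change _ = ∑ i ∈ (ℛ k t).index, ∑ j ∈ (ℛ k h).index,
      (gen c (counit (R := k) ((ℛ k t).left i) • (ℛ k h).left j) ⊗ₜ[k] (1 : CrossedProduct c)) *
        casimir c ((ℛ k t).right i * (ℛ k h).right j)
    rw [Finset.sum_comm]
    conv_lhs => rw [← sum_counit_right_smul (ℛ k h), map_sum, sum_tmul, Finset.sum_mul]
    refine Finset.sum_congr rfl fun j _ => ?_
    conv_lhs => rw [map_smul, ← smul_tmul', smul_mul_assoc, ← mul_smul_comm, ← map_smul, ← ht]
    conv_lhs => rw [← sum_counit_smul (ℛ k t), Finset.sum_mul, map_sum, Finset.mul_sum]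
    refine Finset.sum_congr rfl fun i _ => ?_
    simp only [map_smul, smul_mul_assoc, mul_smul_comm, ← smul_tmul']
  rw [e1, e2, hB.conv_eq]

/-- Centrality in the tensor product over `R` is tested against balanced maps. The elements `incl c
r * gen c h` span, so the two preceding cases suffice. -/
lemma casimir_comm (hB : IsBalanced (incl c) B) {t : H}
    (ht : ∀ h, t * h = counit (R := k) h • t) (a : CrossedProduct c) :
    B (casimir c t * (1 ⊗ₜ a)) = B ((a ⊗ₜ 1) * casimir c t) := by
  obtain ⟨a, rfl⟩ := (mk c).surjective a
  induction a with
  | zero => simp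
  | add x y hx hy => simp only [map_add, tmul_add, add_tmul, mul_add, add_mul, hx, hy]
  | tmul r h =>
    rw [mk_tmul]
    have e1 : (1 : CrossedProduct c) ⊗ₜ[k] (incl c r * gen c h) =
        (1 ⊗ₜ incl c r) * (1 ⊗ₜ gen c h) := by simp
    have e2 : (incl c r * gen c h) ⊗ₜ[k] (1 : CrossedProduct c) =
        (incl c r ⊗ₜ 1) * (gen c h ⊗ₜ 1) := by simp
    -- Translating `B` by the outer multiplications keeps it balanced, so the two factors can be
    -- moved one after the other.
    have h1 : IsBalanced (incl c) (B ∘ₗ LinearMap.mulRight k (1 ⊗ₜ gen c h)) := by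
      intro s x y
      simpa [mul_assoc] using hB s x (y * gen c h)
    have h2 : IsBalanced (incl c) (B ∘ₗ LinearMap.mulLeft k (incl c r ⊗ₜ 1)) := by
      intro s x y
      simpa [mul_assoc] using hB s (incl c r * x) y
    have h3 := casimir_incl c h1 t r
    have h4 := casimir_gen c h2 ht h
    simp only [LinearMap.comp_apply, LinearMap.mulRight_apply, LinearMap.mulLeft_apply] at h3 h4
    rw [e1, e2, ← mul_assoc, h3, mul_assoc, h4, mul_assoc]

end CrossedProduct

/-! ### Extension and contraction of ideals -/

namespace CrossedProduct

section Ideal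

variable {k H R : Type*} [Field k] [Ring H] [Bialgebra k H] [Ring R] [Algebra k R]
  {W : WeakAction k H R} (c : CrossedSystem W)

/-- The image of `I ⊗ H` in `R ⊗ H`. -/
abbrev idealTensor (k H : Type*) {R : Type*} [Field k] [Ring H] [Algebra k H] [Ring R]
    [Algebra k R] (I : Ideal R) : Submodule k (R ⊗[k] H) :=
  LinearMap.range ((I.restrictScalars k).subtype.rTensor H)

lemma tmul_mem_idealTensor {I : Ideal R} {n : R} (hn : n ∈ I) (h : H) :
    n ⊗ₜ[k] h ∈ idealTensor k H I := ⟨⟨n, hn⟩ ⊗ₜ h, rfl⟩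

lemma idealTensor_induction {I : Ideal R} {p : R ⊗[k] H → Prop} (h0 : p 0)
    (hadd : ∀ x y, p x → p y → p (x + y)) (htmul : ∀ n ∈ I, ∀ h, p (n ⊗ₜ h))
    {x : R ⊗[k] H} (hx : x ∈ idealTensor k H I) : p x := by
  obtain ⟨y, rfl⟩ := hx
  induction y with
  | zero => simpa using h0
  | add y z hy hz => rw [map_add]; exact hadd _ _ hy hz
  | tmul n h => exact htmul n.1 n.2 h

lemma smul_mem_idealTensor {I : Ideal R} (hI : I.IsTwoSided) {n : R} (hn : n ∈ I)
    (x : R ⊗[k] H) : n • x ∈ idealTensor k H I := by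
  induction x with
  | zero => simp
  | add x y hx hy => rw [smul_add]; exact add_mem hx hy
  | tmul a h =>
    rw [smul_tmul', smul_eq_mul]
    exact tmul_mem_idealTensor (I.mul_mem_right a hn) h

lemma incl_mul_mem {I : Ideal R} (hI : I.IsTwoSided) {n : R} (hn : n ∈ I)
    (x : CrossedProduct c) : incl c n * x ∈ ofIdeal c I := by
  obtain ⟨y, rfl⟩ := (mk c).surjective x
  rw [incl_mul]
  exact smul_mem_idealTensor hI hn y

lemma ofIdeal_induction {I : Ideal R} {p : CrossedProduct c → Prop} (h0 : p 0)
    (hadd : ∀ x y, p x → p y → p (x + y)) (hmul : ∀ n ∈ I, ∀ h, p (incl c n * gen c h))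
    {x : CrossedProduct c} (hx : x ∈ ofIdeal c I) : p x :=
  idealTensor_induction (p := fun y => p (mk c y)) h0 hadd
    (fun n hn h => by rw [mk_tmul]; exact hmul n hn h) hx

lemma mul_mem_ofIdeal {I : Ideal R} (hI : W.IsHIdeal I) (y : CrossedProduct c)
    {x : CrossedProduct c} (hx : x ∈ ofIdeal c I) : y * x ∈ ofIdeal c I := by
  have hadd : ∀ x y : CrossedProduct c, x ∈ ofIdeal c I → y ∈ ofIdeal c I → x + y ∈ ofIdeal c I :=
    fun x y hx hy => (idealTensor k H I).add_mem hx hy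
  have h0 : (0 : CrossedProduct c) ∈ ofIdeal c I := (idealTensor k H I).zero_mem
  refine ofIdeal_induction c (p := fun x => y * x ∈ ofIdeal c I) (by rwa [mul_zero])
    (fun x z hx hz => by rw [mul_add]; exact hadd _ _ hx hz) (fun n hn h => ?_) hx
  obtain ⟨y, rfl⟩ := (mk c).surjective y
  induction y with
  | zero => rwa [map_zero, zero_mul]
  | add x y hx hy => rw [map_add, add_mul]; exact hadd _ _ hx hy
  | tmul a g =>
    rw [mk_tmul, mul_assoc, ← mul_assoc (gen c g), gen_mul_incl, (ℛ k g).convMul_apply,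
      Finset.sum_mul, Finset.mul_sum]
    refine (idealTensor k H I).sum_mem fun i _ => ?_
    change incl c a * (incl c (W.act _ n) * gen c _ * gen c h) ∈ ofIdeal c I
    rw [mul_assoc, ← mul_assoc, ← map_mul]
    exact incl_mul_mem c hI.isTwoSided (I.mul_mem_left _ (hI.act_mem _ n hn)) _

/-- The ideal `I #_σ H` of the crossed product, for an `H`-ideal `I`. -/
def hIdeal {I : Ideal R} (hI : W.IsHIdeal I) : Ideal (CrossedProduct c) where
  carrier := ofIdeal c I
  zero_mem' := (idealTensor k H I).zero_mem
  add_mem' hx hy := (idealTensor k H I).add_mem hx hy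
  smul_mem' y _ hx := mul_mem_ofIdeal c hI y hx

lemma mem_hIdeal {I : Ideal R} (hI : W.IsHIdeal I) {x : CrossedProduct c} :
    x ∈ hIdeal c hI ↔ x ∈ ofIdeal c I := Iff.rfl

lemma hIdeal_isTwoSided {I : Ideal R} (hI : W.IsHIdeal I) : (hIdeal c hI).IsTwoSided := by
  refine ⟨fun {x} y hx => ?_⟩
  refine ofIdeal_induction c (p := fun x => x * y ∈ hIdeal c hI) (by simp)
    (fun x z hx hz => by rw [add_mul]; exact add_mem hx hz) (fun n hn h => ?_) hx
  rw [mul_assoc]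
  exact incl_mul_mem c hI.isTwoSided hn _

lemma incl_mem_hIdeal {I : Ideal R} (hI : W.IsHIdeal I) {n : R} (hn : n ∈ I) :
    incl c n ∈ hIdeal c hI := by
  have := incl_mul_mem c hI.isTwoSided hn 1
  rwa [mul_one] at this

/-- Ideals `I`, `J` of `R` are `H`-ideals, so they extend to ideals of the crossed product. Their
product is contained in `P` as soon as `I J` contracts into `P`, because `(J # H)` absorbs the
factor `gen c h` from the left. -/
lemma isPrimeIdeal_comap_incl (hW : W.IsInner) {P : Ideal (CrossedProduct c)}
    (hP : IsPrimeIdeal P) : IsPrimeIdeal (P.comap (incl c)) where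
  isTwoSided := ⟨fun b ha => by
    have := hP.isTwoSided
    rw [Ideal.mem_comap, map_mul]
    exact P.mul_mem_right _ ha⟩
  ne_top h := hP.ne_top ((Ideal.eq_top_iff_one _).2 (by
    rw [← map_one (incl c)]
    exact Ideal.mem_comap.1 (h ▸ Submodule.mem_top)))
  le_or_le I J hI hJ hIJ := by
    have := hP.isTwoSided
    have hI' := hW.isHIdeal hI
    have hJ' := hW.isHIdeal hJ
    have hle : hIdeal c hI' * hIdeal c hJ' ≤ P := by
      refine Ideal.mul_le.2 fun x hx y hy => ?_
      refine ofIdeal_induction c (p := fun x => x * y ∈ P) (by simp)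
        (fun x z hx hz => by rw [add_mul]; exact add_mem hx hz) (fun n hn h => ?_) hx
      rw [mul_assoc]
      refine ofIdeal_induction c (p := fun y => incl c n * y ∈ P) (by simp)
        (fun x z hx hz => by rw [mul_add]; exact add_mem hx hz) (fun m hm g => ?_)
        (mul_mem_ofIdeal c hJ' (gen c h) hy)
      rw [← mul_assoc, ← map_mul]
      exact P.mul_mem_right _ (hIJ (Ideal.mul_mem_mul hn hm))
    exact (hP.le_or_le _ _ (hIdeal_isTwoSided c hI') (hIdeal_isTwoSided c hJ') hle).imp
      (fun h n hn => h (incl_mem_hIdeal c hI' hn)) (fun h n hn => h (incl_mem_hIdeal c hJ' hn))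

lemma hIdeal_baerRadical_le (hW : W.IsInner)
    (hN : W.IsHIdeal (baerRadical R)) : hIdeal c hN ≤ baerRadical (CrossedProduct c) := by
  refine le_sInf fun P hP x hx => ?_
  have := hP.isTwoSided
  refine ofIdeal_induction c (p := (· ∈ P)) (zero_mem P) (fun x y => add_mem) (fun n hn h => ?_) hx
  have hn' : baerRadical R ≤ P.comap (incl c) := sInf_le (isPrimeIdeal_comap_incl c hW hP)
  exact P.mul_mem_right _ (hn' hn)

end Ideal

/-! ### A free basis that centralizes `R` -/

section Twist

open Algebra.TensorProduct

variable {k H R : Type*} [Field k] [Ring H] [Bialgebra k H] [Ring R] [Algebra k R]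

/-- The map `h ↦ ∑ f(h₁) ⊗ h₂`. -/
def twistElem (f : WithConv (H →ₗ[k] R)) : WithConv (H →ₗ[k] R ⊗[k] H) :=
  convMap H includeLeft f * convMap H includeRight (toConv LinearMap.id)

/-- The map `a ⊗ h ↦ ∑ a f(h₁) ⊗ h₂`. -/
def twist (f : WithConv (H →ₗ[k] R)) : R ⊗[k] H →ₗ[k] R ⊗[k] H :=
  LinearMap.mul' k _ ∘ₗ TensorProduct.map
    (includeLeft : R →ₐ[k] R ⊗[k] H).toLinearMap (twistElem f).ofConv

lemma twist_tmul (f : WithConv (H →ₗ[k] R)) (a : R) (h : H) :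
    twist f (a ⊗ₜ h) = a • twistElem f h :=
  CrossedSystem.includeLeft_mul a _

lemma twist_smul (f : WithConv (H →ₗ[k] R)) (a : R) (x : R ⊗[k] H) :
    twist f (a • x) = a • twist f x := by
  induction x with
  | zero => simp
  | add x y hx hy => rw [smul_add, map_add, map_add, smul_add, hx, hy]
  | tmul b h => rw [smul_tmul', twist_tmul, twist_tmul, smul_eq_mul, mul_smul]

/-- Twists by convolution inverse maps are thus inverse bijections, so a twist carries one left
`R`-basis to another. -/
lemma twist_twist (f g : WithConv (H →ₗ[k] R)) (x : R ⊗[k] H) :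
    twist g (twist f x) = twist (f * g) x := by
  induction x with
  | zero => simp
  | add x y hx hy => rw [map_add, map_add, map_add, hx, hy]
  | tmul a h =>
    rw [twist_tmul, twist_smul, twist_tmul]
    refine congrArg _ ?_
    rw [twistElem, (ℛ k h).convMul_apply, map_sum, twistElem, map_mul, mul_assoc]
    refine Eq.trans ?_ ((ℛ k h).convMul_apply _ _).symm
    refine Finset.sum_congr rfl fun i _ => ?_
    change twist g ((f ((ℛ k h).left i) ⊗ₜ[k] (1 : H)) * (1 ⊗ₜ[k] (ℛ k h).right i)) = _
    rw [Algebra.TensorProduct.tmul_mul_tmul, mul_one, one_mul, twist_tmul]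
    exact (CrossedSystem.includeLeft_mul _ _).symm

lemma twist_one (x : R ⊗[k] H) : twist 1 x = x := by
  induction x with
  | zero => simp
  | add x y hx hy => rw [map_add, hx, hy]
  | tmul a h =>
    rw [twist_tmul, twistElem, map_one, one_mul]
    simp [convMap, smul_tmul']

lemma twist_mem_idealTensor (f : WithConv (H →ₗ[k] R)) {I : Ideal R} (hI : I.IsTwoSided)
    {x : R ⊗[k] H} (hx : x ∈ idealTensor k H I) : twist f x ∈ idealTensor k H I := by
  refine idealTensor_induction (p := fun x => twist f x ∈ idealTensor k H I) (by simp)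
    (fun x y hx hy => by rw [map_add]; exact add_mem hx hy) (fun n hn h => ?_) hx
  rw [twist_tmul]
  exact smul_mem_idealTensor hI hn _

lemma contract_mem_of_mem_idealTensor {I : Ideal R} (φ : H →ₗ[k] k) {x : R ⊗[k] H}
    (hx : x ∈ idealTensor k H I) : TensorProduct.rid k R (φ.lTensor R x) ∈ I := by
  refine idealTensor_induction (p := fun x => TensorProduct.rid k R (φ.lTensor R x) ∈ I) (by simp)
    (fun x y hx hy => by rw [map_add, map_add]; exact add_mem hx hy) (fun m hm h => ?_) hx
  simpa using (I.restrictScalars k).smul_mem _ hm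

lemma mem_of_sum_tmul_mem_idealTensor {n : Type*} [Fintype n] (b : Module.Basis n k H) {I : Ideal R}
    (a : n → R) (h : ∑ i, a i ⊗ₜ[k] b i ∈ idealTensor k H I) (i : n) : a i ∈ I := by
  classical
  simpa [Finsupp.single_apply] using contract_mem_of_mem_idealTensor (b.coord i) h

lemma exists_eq_sum_tmul {n : Type*} [Fintype n] (b : Module.Basis n k H) (x : R ⊗[k] H) :
    ∃ a : n → R, x = ∑ i, a i ⊗ₜ[k] b i := by
  induction x with
  | zero => exact ⟨0, by simp⟩
  | add x y hx hy =>
    obtain ⟨a, rfl⟩ := hx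
    obtain ⟨d, rfl⟩ := hy
    exact ⟨a + d, by simp [add_tmul, Finset.sum_add_distrib]⟩
  | tmul r h =>
    refine ⟨fun i => b.repr h i • r, ?_⟩
    conv_lhs => rw [← b.sum_repr h]
    simp only [tmul_sum, tmul_smul, smul_tmul']

end Twist

section Centralizing

variable {k H R : Type*} [Field k] [Ring H] [Bialgebra k H] [Ring R] [Algebra k R]
  {W : WeakAction k H R} (c : CrossedSystem W)

/-- The map `h ↦ ∑ f(h₁) # h₂`. -/
def twistGen (f : WithConv (H →ₗ[k] R)) : WithConv (H →ₗ[k] CrossedProduct c) :=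
  convMap H (incl c) f * gen c

lemma incl_mul_twistGen (f : WithConv (H →ₗ[k] R)) (a : R) (h : H) :
    incl c a * twistGen c f h = mk c (twist f (a ⊗ₜ h)) := by
  rw [twist_tmul, ← incl_mul, twistGen, twistElem, (ℛ k h).convMul_apply,
    (ℛ k h).convMul_apply, map_sum]
  refine congrArg _ (Finset.sum_congr rfl fun i _ => ?_)
  change _ = mk c ((f ((ℛ k h).left i) ⊗ₜ[k] (1 : H)) * (1 ⊗ₜ[k] (ℛ k h).right i))
  rw [Algebra.TensorProduct.tmul_mul_tmul, mul_one, one_mul, mk_tmul]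
  rfl

/-- If `h · a = ∑ u(h₁) a u⁻¹(h₂)`, then the elements `∑ u⁻¹(h₁) # h₂` centralize `R`. -/
lemma twistGen_mul_incl (u : (WithConv (H →ₗ[k] R))ˣ) (hu : ∀ h a, W.act h a =
    LinearMap.mul' k R (TensorProduct.map (LinearMap.mulRight k a ∘ₗ u.val.ofConv)
      u.inv.ofConv (comul (R := k) h))) (h : H) (a : R) :
    twistGen c u.inv h * incl c a = incl c a * twistGen c u.inv h := by
  have hW : toConv (W.act.flip a) = u.val * convConst H a * u.inv := by
    have h1 : u.val * convConst H a = toConv (LinearMap.mulRight k a ∘ₗ u.val.ofConv) :=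
      WithConv.ext (LinearMap.ext fun x => conv_mul_const u.val a x)
    rw [h1]
    exact WithConv.ext (LinearMap.ext fun x => hu x a)
  have hg : gen c * convConst H (incl c a) =
      convMap H (incl c) (toConv (W.act.flip a)) * gen c :=
    WithConv.ext (LinearMap.ext fun x => (conv_mul_const _ _ x).trans (gen_mul_incl c x a))
  -- Moving `a` past `γ` replaces it by `u * a * u⁻¹`, and the leading `u⁻¹` cancels `u`.
  have key : twistGen c u.inv * convConst H (incl c a) =
      convConst H (incl c a) * twistGen c u.inv := by
    rw [twistGen, mul_assoc, hg, ← mul_assoc, ← map_mul, hW, ← mul_assoc, ← mul_assoc, u.inv_val,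
      one_mul, map_mul, convMap_convConst, mul_assoc]
  rw [← conv_mul_const, key, convConst_mul]

end Centralizing

/-! ### Semiprimeness of the extended ideal -/

section Semisimple

variable {k H R : Type*} [Field k] [Ring H] [HopfAlgebra k H] [Ring R] [Algebra k R]
  {W : WeakAction k H R} (c : CrossedSystem W)

/-- Averaging over a Casimir element of the crossed product makes `R`-linear maps into a quotient
of the crossed product linear over the crossed product. -/
lemma sum_casimir_comm {t : H} (ht : ∀ h, t * h = counit (R := k) h • t)
    {Q : Ideal (CrossedProduct c)} [Q.IsTwoSided]
    (g : CrossedProduct c ⧸ Q →+ CrossedProduct c ⧸ Q)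
    (hg : ∀ r x, g (Ideal.Quotient.mk Q (incl c r) * x) = Ideal.Quotient.mk Q (incl c r) * g x)
    (a : CrossedProduct c ⧸ Q) :
    ∑ j ∈ (ℛ k t).index, Ideal.Quotient.mk Q (genInv c ((ℛ k t).left j)) *
      g (Ideal.Quotient.mk Q (gen c ((ℛ k t).right j)) * a) =
    a * ∑ j ∈ (ℛ k t).index, Ideal.Quotient.mk Q (genInv c ((ℛ k t).left j)) *
      g (Ideal.Quotient.mk Q (gen c ((ℛ k t).right j))) := by
  obtain ⟨a, rfl⟩ := Ideal.Quotient.mk_surjective a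
  let q := Ideal.Quotient.mkₐ k Q
  -- Scalars act through `R`, so the additive map `g` is automatically `k`-linear.
  let gk : CrossedProduct c ⧸ Q →ₗ[k] CrossedProduct c ⧸ Q :=
    { g with
      map_smul' := fun s x => by
        have h := hg (algebraMap k R s) x
        rw [AlgHom.commutes, Ideal.Quotient.mk_algebraMap, ← Algebra.smul_def,
          ← Algebra.smul_def] at h
        exact h }
  let B : CrossedProduct c ⊗[k] CrossedProduct c →ₗ[k] CrossedProduct c ⧸ Q :=
    LinearMap.mul' k _ ∘ₗ TensorProduct.map q.toLinearMap (gk ∘ₗ q.toLinearMap)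
  have hBt : ∀ x y, B (x ⊗ₜ y) = Ideal.Quotient.mk Q x * g (Ideal.Quotient.mk Q y) :=
    fun x y => rfl
  have hB : IsBalanced (incl c) B := by
    intro r x y
    rw [hBt, hBt, map_mul, map_mul, hg, mul_assoc]
  have hcas : casimir c t = ∑ j ∈ (ℛ k t).index,
      genInv c ((ℛ k t).left j) ⊗ₜ[k] gen c ((ℛ k t).right j) := by
    rw [casimir, (ℛ k t).convMul_apply]
    simp [convMap]
  have h := casimir_comm c hB ht a
  rw [hcas, Finset.sum_mul, Finset.mul_sum, map_sum, map_sum] at h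
  simpa only [Algebra.TensorProduct.tmul_mul_tmul, mul_one, one_mul, hBt, map_mul, mul_assoc,
    Finset.mul_sum] using h

/-- If the weak action is inner, `H` is semisimple and `N` is a semiprime ideal of `R`, then
`N #_σ H` is a semiprime ideal of the crossed product. -/
lemma hIdeal_isSemiprimeIdeal [FiniteDimensional k H] [IsSemisimpleRing H] (hW : W.IsInner)
    {N : Ideal R} (hN : IsSemiprimeIdeal N) (hN' : W.IsHIdeal N) :
    IsSemiprimeIdeal (hIdeal c hN') := by
  refine ⟨hIdeal_isTwoSided c hN', fun J hJ hJJ => ?_⟩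
  have hQ2 := hIdeal_isTwoSided c hN'
  obtain ⟨u, hu⟩ := hW
  obtain ⟨t, ht1, ht⟩ := exists_right_integral k H
  set Q := hIdeal c hN'
  let q := Ideal.Quotient.mk Q
  let b := Module.finBasis k H
  have hsum : ∀ a : Fin (Module.finrank k H) → R, ∑ i, incl c (a i) * twistGen c u.inv (b i) =
      mk c (twist u.inv (∑ i, a i ⊗ₜ b i)) := fun a => by
    rw [map_sum, map_sum]
    exact Finset.sum_congr rfl fun i _ => incl_mul_twistGen c _ _ _
  have hker : RingHom.ker (q.comp (incl c).toRingHom) = N := by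
    ext n
    rw [RingHom.mem_ker]
    -- Applying `ε` to the second leg recovers `n` from `n # 1`.
    refine Ideal.Quotient.eq_zero_iff_mem.trans ⟨fun h => ?_, incl_mem_hIdeal c hN'⟩
    have := contract_mem_of_mem_idealTensor (counit (R := k)) h
    change TensorProduct.rid k R (LinearMap.lTensor R counit (n ⊗ₜ[k] (1 : H))) ∈ N at this
    simpa using this
  have h := eq_zero_of_mul_eq_zero_of_casimir (ι := q.comp (incl c).toRingHom) (hker ▸ hN)
    (fun i => q (twistGen c u.inv (b i)))
    (fun i r => by
      change q _ * q _ = q _ * q _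
      rw [← map_mul, ← map_mul]
      exact congrArg q (twistGen_mul_incl c u hu _ _))
    (fun x => by
      obtain ⟨x, rfl⟩ := Ideal.Quotient.mk_surjective x
      obtain ⟨y, rfl⟩ := (mk c).surjective x
      -- The coordinates in the centralizing basis are the ordinary coordinates after undoing the
      -- twist by `u⁻¹`.
      obtain ⟨a, ha⟩ := exists_eq_sum_tmul b (twist u.val y)
      have hy : y = twist u.inv (∑ i, a i ⊗ₜ b i) := by
        rw [← ha, twist_twist, u.val_inv, twist_one]
      refine ⟨a, (congrArg (fun z => q (mk c z)) hy).trans ?_⟩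
      rw [← hsum, map_sum]
      exact Finset.sum_congr rfl fun i _ => map_mul q _ _)
    (fun a ha i => by
      have h0 : q (∑ i, incl c (a i) * twistGen c u.inv (b i)) = 0 := by
        rw [map_sum, ← ha]
        exact Finset.sum_congr rfl fun i _ => map_mul q _ _
      rw [hsum] at h0
      -- Twists preserve `N ⊗ H`, so freeness modulo `Q` reduces to reading off coordinates in `R ⊗
      -- H`.
      have h1 := twist_mem_idealTensor u.val hN.isTwoSided
        ((mem_hIdeal c hN').1 (Ideal.Quotient.eq_zero_iff_mem.1 h0))
      have h2 : twist u.val (mk c (twist u.inv (∑ i, a i ⊗ₜ[k] b i))) = ∑ i, a i ⊗ₜ[k] b i := by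
        refine (twist_twist u.inv u.val _).trans ?_
        rw [u.inv_val, twist_one]
      rw [h2] at h1
      have := mem_of_sum_tmul_mem_idealTensor b a h1 i
      rwa [← hker] at this)
    (fun j : (ℛ k t).index => q (genInv c ((ℛ k t).left j)))
    (fun j : (ℛ k t).index => q (gen c ((ℛ k t).right j)))
    (by
      have h := congrArg q (mul'_casimir c t)
      rw [ht1, map_one, map_one, casimir, (ℛ k t).convMul_apply] at h
      rw [← h, map_sum, map_sum, ← Finset.sum_coe_sort (ℛ k t).index]
      refine Finset.sum_congr rfl fun j _ => ?_
      simp [convMap])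
    (fun g hg a => by
      have := sum_casimir_comm c ht g hg a
      rw [← Finset.sum_coe_sort (ℛ k t).index, ← Finset.sum_coe_sort (ℛ k t).index] at this
      exact this)
    (J.map q)
    (have := RingHomSurjective.mk (σ := q) Ideal.Quotient.mk_surjective; inferInstance)
    (fun x hx y hy => by
      obtain ⟨x, hxJ, rfl⟩ := (Ideal.mem_map_iff_of_surjective q Ideal.Quotient.mk_surjective).1 hx
      obtain ⟨y, hyJ, rfl⟩ := (Ideal.mem_map_iff_of_surjective q Ideal.Quotient.mk_surjective).1 hy
      rw [← map_mul]
      exact Ideal.Quotient.eq_zero_iff_mem.2 (hJJ (Ideal.mul_mem_mul hxJ hyJ)))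
  intro x hx
  have := Ideal.mem_map_of_mem q hx
  rw [h] at this
  exact Ideal.Quotient.eq_zero_iff_mem.1 this

end Semisimple

end CrossedProduct

end

theorem theorem2p5 {k H R : Type*} [Field k] [Ring H] [HopfAlgebra k H] [FiniteDimensional k H]
    [Ring R] [Algebra k R] (W : WeakAction k H R) (hW : W.IsInner) :
    (W.hBaerRadical = baerRadical R ∧ baerRadical R = W.baerRadicalH) ∧
    (IsSemisimpleRing H → ∀ c : CrossedSystem W,
      (baerRadical (CrossedProduct c) : Set (CrossedProduct c)) =
        CrossedProduct.ofIdeal c W.hBaerRadical) := by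
  refine ⟨⟨hW.hBaerRadical_eq, hW.baerRadicalH_eq.symm⟩, fun _ c => ?_⟩
  have hN := baerRadical_isSemiprimeIdeal (A := R)
  have hN' := hW.isHIdeal hN.isTwoSided
  rw [hW.hBaerRadical_eq]
  exact congrArg SetLike.coe (le_antisymm
    (CrossedProduct.hIdeal_isSemiprimeIdeal c hW hN hN').baerRadical_le
    (CrossedProduct.hIdeal_baerRadical_le c hW hN'))
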